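/- **Setting.** Let $d\in\{2,3\}$, $\nu,\mu>0$, $a\ge 0$, let $e_2\in\mathbb R^d$ be a unit vector (opposite to gravity), and let $\hat u_0:\mathbb R^d\to\mathbb C^d$, $\hat\Theta_0:\mathbb R^d\to\mathbb C$, $\hat f:\mathbb R^d\to\mathbb C^d$ be measurable (the Fourier transforms of the initial velocity, initial temperature and time-independent forcing of the Boussinesq equation $u_t-\nu\Delta u=-P[u\cdot\nabla u-ae_2\Theta]+f$, $\Theta_t-\mu\Delta\Theta=-u\cdot\nabla\Theta$). Let $\|\cdot\|_N$ be either $\|\hat g\|_{\gamma,\beta}=\sup_k(1+|k|)^\gamma e^{\beta|k|}|\hat g(k)|$ with $\gamma>d$, $\beta\ge0$, and put $C_0=2^{\gamma+1}\int_{\mathbb R^d}(1+|k|)^{-\gamma}dk$; or $\|\hat g\|_{L^1\cap L^\infty}=\max\{\int|\hat g|\,dk,\ \sup_k|\hat g(k)|\}$, and put $C_0=1$. For pairs, $|\cdot|$ is the Euclidean modulus on $\mathbb C^{d+1}$. Assume $\|(1+|k|)^2(\hat u_0,\hat\Theta_0)\|_N<\infty$ and $\|\hat f\|_N<\infty$.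 Write $P_k=1-k(k\cdot)/|k|^2$, $\hat*$ for convolution in $k$, ${}^*_*$ for convolution in $k$ together with Laplace convolution in $p$, $\mathcal G(z,z')=z'\{-J_1(z)Y_1(z')+Y_1(z)J_1(z')\}$, $z=2|k|\sqrt{\nu p}$, $z'=2|k|\sqrt{\nu p'}$, $\zeta=2|k|\sqrt{\mu p}$, $\zeta'=2|k|\sqrt{\mu p'}$ (at $k=0$ the quotients $\mathcal G(z,z')/z$, $J_1(z)/z$, and likewise with $\zeta$, are replaced by their limits, and $P_0=1$); sum over repeated $j$. Put $$\hat u_1=-\nu|k|^2\hat u_0-ik_jP_k[\hat u_{0,j}\hat*\hat u_0]+aP_k[e_2\hat\Theta_0]+\hat f,\qquad \hat\Theta_1=-\mu|k|^2\hat\Theta_0-ik_j(\hat u_{0,j}\hat*\hat\Theta_0),$$ $$\hat G^{[1]}_j=-P_k[\hat u_{0,j}\hat*\hat H+\hat H_j\hat*\hat u_0+\hat H_j{}^*_*\hat H],\qquad \hat G^{[2]}_j=-[\hat u_{0,j}\hat*\hat S+\hat H_j\hat*\hat\Theta_0+\hat H_j{}^*_*\hat S].$$ Let $(\hat H,\hat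 S)(k,p)$, $p>0$, be measurable with $\|(\hat H,\hat S)(\cdot,p)\|_N$ locally integrable in $p\in[0,\infty)$, and a solution of $$\hat H(k,p)=ik_j\frac{\pi}{z}\int_0^p\mathcal G(z,z')\hat G^{[1]}_j(k,p')\,dp'+a\frac{\pi}{z}\int_0^p\mathcal G(z,z')P_k[e_2\hat S(k,p')]\,dp'+2\hat u_1(k)\frac{J_1(z)}{z},$$ $$\hat S(k,p)=ik_j\frac{\pi}{\zeta}\int_0^p\mathcal G(\zeta,\zeta')\hat G^{[2]}_j(k,p')\,dp'+2\hat\Theta_1(k)\frac{J_1(\zeta)}{\zeta}.$$ Let $p_0>0$. Let $(\hat H,\hat S)^{(a)}$ equal $(\hat H,\hat S)$ for $p\in(0,p_0]$ and $0$ otherwise, let $\hat G^{[1],(a)}_j,\hat G^{[2],(a)}_j$ be $\hat G^{[1]}_j,\hat G^{[2]}_j$ formed with $(\hat H,\hat S)^{(a)}$, and let $(\hat H,\hat S)^{(s)}(k,p)$ be the right-hand sides of the two equations formed with $(\hat H,\hat S)^{(a)}$, where the integrals of $\hat G^{[1],(a)}_j$ and $\hat G^{[2],(a)}_j$ run over $[0,\min(p,2p_0)]$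 and the integral of $\hat S^{(a)}$ over $[0,\min(p,p_0)]$. For $\omega_0\ge0$ define, with values in $[0,\infty]$, $$\mathcal B_0(k)=\pi C_0\sup_{p_0\le p'\le p}\max\left\{\left|\frac{\mathcal G(z,z')}{z}\right|,\left|\frac{\mathcal G(\zeta,\zeta')}{\zeta}\right|\right\},\qquad \mathcal B_3=\sup_k|k|\mathcal B_0(k),\qquad \mathcal B_4=a\sup_k\mathcal B_0(k),$$ $$\mathcal B_1=2\mathcal B_3\|(\hat u_0,\hat\Theta_0)\|_N,\qquad \mathcal B_2(p)=2\mathcal B_3\|(\hat H,\hat S)^{(a)}(\cdot,p)\|_N,$$ $$b=\omega_0\int_{p_0}^\infty e^{-\omega_0p}\|(\hat H,\hat S)^{(s)}(\cdot,p)\|_N\,dp,\qquad \epsilon_1=\mathcal B_1+\mathcal B_4+\int_0^{p_0}e^{-\omega_0p}\mathcal B_2(p)\,dp .$$ **Theorem (Improved exponential estimates).** For every $\omega\ge\omega_0$ with $\omega>\epsilon_1+2\sqrt{\mathcal B_3b}$, and such that $\omega=\omega_0$ or $\omega_0p_0\ge1$, $$\int_0^\infty e^{-\omega p}\,\|(\hat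 H,\hat S)(\cdot,p)\|_N\,dp<\infty .$$ -/

import Mathlib

open MeasureTheory Set
open scoped ENNReal

noncomputable section

namespace Boussinesq

/-- Wave vectors `k ∈ ℝ^d`, with the Euclidean norm. -/
abbrev Wave (d : ℕ) := EuclideanSpace ℝ (Fin d)

/-- Values of Fourier transforms of vector fields: `ℂ^d`, with the Hermitian norm. -/
abbrev CVec (d : ℕ) := EuclideanSpace ℂ (Fin d)

/-! ### Bessel functions of order one -/

/-- The Bessel function of the first kind `J₁`. -/
def besselJ1 (x : ℝ) : ℝ :=
  ∑' m : ℕ, (-1 : ℝ) ^ m / ((m.factorial : ℝ) * ((m + 1).factorial : ℝ)) * (x / 2) ^ (2 * m + 1)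

/-- The Bessel function of the second kind `Y₁` on `(0, ∞)`, by its standard expansion; here
`ψ(m+1) + ψ(m+2) = H_m + H_{m+1} - 2γ`, with `ψ` the digamma function, `H_m` the harmonic numbers
and `γ` the Euler–Mascheroni constant. -/
def besselY1 (x : ℝ) : ℝ :=
  -2 / (Real.pi * x) + 2 / Real.pi * Real.log (x / 2) * besselJ1 x
    - 1 / Real.pi * ∑' m : ℕ,
        ((harmonic m : ℝ) + (harmonic (m + 1) : ℝ) - 2 * Real.eulerMascheroniConstant)
          * ((-1 : ℝ) ^ m / ((m.factorial : ℝ) * ((m + 1).factorial : ℝ)))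
          * (x / 2) ^ (2 * m + 1)

/-- `𝒢(z, z') = z' (-J₁(z) Y₁(z') + Y₁(z) J₁(z'))`. -/
def kernelG (z z' : ℝ) : ℝ :=
  z' * (-besselJ1 z * besselY1 z' + besselY1 z * besselJ1 z')

/-- `z = 2 |k| √(κ p)`, for a diffusivity `κ` (which is `ν` or `μ`). -/
def zVar {d : ℕ} (κ : ℝ) (k : Wave d) (p : ℝ) : ℝ := 2 * ‖k‖ * Real.sqrt (κ * p)

/-- The kernel `π 𝒢(z, z') / z` with `z = 2|k|√(κp)`, `z' = 2|k|√(κp')`. At `k = 0` the formula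
reads `0/0`, and the value is the limit as `k → 0`, which is `1 - p'/p`. -/
def borelKernel {d : ℕ} (κ : ℝ) (k : Wave d) (p p' : ℝ) : ℝ :=
  if k = 0 then 1 - p' / p
  else Real.pi * kernelG (zVar κ k p) (zVar κ k p') / zVar κ k p

/-- `2 J₁(z) / z` with `z = 2|k|√(κp)`, extended by its limit `1` at `k = 0`. -/
def borelSource {d : ℕ} (κ : ℝ) (k : Wave d) (p : ℝ) : ℝ :=
  if k = 0 then 1 else 2 * besselJ1 (zVar κ k p) / zVar κ k p

/-! ### Norms in the wave vector -/

/-- The two choices for the norm `‖·‖_N`: the weighted norm `‖·‖_{γ,β}` or the norm of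
`L¹ ∩ L^∞`. -/
inductive FourierNorm where
  | weighted (γ β : ℝ)
  | l1linf

/-- The standing assumptions `γ > d`, `β ≥ 0` on the weights. -/
def FourierNorm.Admissible (d : ℕ) : FourierNorm → Prop
  | .weighted γ β => (d : ℝ) < γ ∧ 0 ≤ β
  | .l1linf => True

/-- `‖g‖_N ∈ [0, ∞]` of a function of `k`, given through its modulus `g`. -/
def FourierNorm.nrm {d : ℕ} (N : FourierNorm) (g : Wave d → ℝ) : ℝ≥0∞ :=
  match N with
  | .weighted γ β =>
      ⨆ k : Wave d, ENNReal.ofReal ((1 + ‖k‖) ^ γ * Real.exp (β * ‖k‖)) * ‖g k‖ₑ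
  | .l1linf => max (∫⁻ k : Wave d, ‖g k‖ₑ) (⨆ k : Wave d, ‖g k‖ₑ)

/-- The constant `C₀` of the algebra property `‖v̂ * ŵ‖_N ≤ C₀ ‖v̂‖_N ‖ŵ‖_N`:
`2^{γ+1} ∫ (1+|k|)^{-γ} dk` for the weighted norm, and `1` for `L¹ ∩ L^∞`. -/
def FourierNorm.C0 (d : ℕ) : FourierNorm → ℝ≥0∞
  | .weighted γ _ =>
      ENNReal.ofReal (2 ^ (γ + 1)) * ∫⁻ k : Wave d, ENNReal.ofReal ((1 + ‖k‖) ^ (-γ))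
  | .l1linf => 1

/-- The Euclidean modulus `|(v, s)|` of a pair in `ℂ^d × ℂ`. -/
def pairAbs {d : ℕ} (v : CVec d) (s : ℂ) : ℝ := Real.sqrt (‖v‖ ^ 2 + ‖s‖ ^ 2)

/-! ### Fourier and Laplace convolutions, the Hodge projection -/

section Convolutions

variable {d : ℕ} {V : Type*} [NormedAddCommGroup V] [NormedSpace ℂ V]

/-- The Fourier convolution `(f * g)(k) = ∫ f(q) g(k - q) dq`. -/
def fourierConv (f : Wave d → ℂ) (g : Wave d → V) (k : Wave d) : V :=
  ∫ q : Wave d, f q • g (k - q)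

/-- The convolution in both variables: Fourier in `k`, Laplace in `p`. -/
def fourierLaplaceConv (F : Wave d → ℝ → ℂ) (G : Wave d → ℝ → V) (k : Wave d) (p : ℝ) : V :=
  ∫ s in (0 : ℝ)..p, fourierConv (fun q => F q s) (fun q => G q (p - s)) k

end Convolutions

/-- The Fourier symbol `P_k v = v - k (k·v)/|k|²` of the Hodge projection (`P_0 v = v`). -/
def hodge {d : ℕ} (k : Wave d) (v : CVec d) : CVec d :=
  WithLp.toLp 2 fun i => v i - (k i : ℂ) * (∑ j, (k j : ℂ) * v j) / ((‖k‖ ^ 2 : ℝ) : ℂ)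

/-- The vector `s e`, for a real vector `e` and a complex number `s`. -/
def scaleVec {d : ℕ} (e : Wave d) (s : ℂ) : CVec d :=
  WithLp.toLp 2 fun i => (e i : ℂ) * s

/-! ### The integral equations in the Borel plane -/

/-- Parameters and data of the Boussinesq equation on the Fourier side: viscosity `ν`, thermal
diffusivity `μ`, buoyancy parameter `a`, the direction `e` opposite to gravity, and the Fourier
transforms of the initial velocity, initial temperature and time-independent forcing. -/
structure Data (d : ℕ) where
  ν : ℝ
  μ : ℝ
  a : ℝ
  e : Wave d
  u0 : Wave d → CVec d
  Θ0 : Wave d → ℂ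
  f : Wave d → CVec d

section Equations

variable {d : ℕ} (D : Data d)

/-- `û₁ = -ν|k|² û₀ - i k_j P_k[û_{0,j} * û₀] + a P_k[e Θ̂₀] + f̂`. -/
def u1 (k : Wave d) : CVec d :=
  -((D.ν * ‖k‖ ^ 2 : ℝ) : ℂ) • D.u0 k
    - ∑ j, (Complex.I * (k j : ℂ)) • hodge k (fourierConv (fun q => D.u0 q j) D.u0 k)
    + (D.a : ℂ) • hodge k (scaleVec D.e (D.Θ0 k)) + D.f k

/-- `Θ̂₁ = -μ|k|² Θ̂₀ - i k_j (û_{0,j} * Θ̂₀)`. -/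
def Θ1 (k : Wave d) : ℂ :=
  -((D.μ * ‖k‖ ^ 2 : ℝ) : ℂ) * D.Θ0 k
    - ∑ j, (Complex.I * (k j : ℂ)) * fourierConv (fun q => D.u0 q j) D.Θ0 k

/-- `Ĝ_j^{[1]} = -P_k[û_{0,j} * Ĥ + Ĥ_j * û₀ + Ĥ_j ** Ĥ]`. -/
def G1 (H : Wave d → ℝ → CVec d) (j : Fin d) (k : Wave d) (p : ℝ) : CVec d :=
  -hodge k (fourierConv (fun q => D.u0 q j) (fun q => H q p) k
    + fourierConv (fun q => H q p j) D.u0 k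
    + fourierLaplaceConv (fun q s => H q s j) H k p)

/-- `Ĝ_j^{[2]} = -[û_{0,j} * Ŝ + Ĥ_j * Θ̂₀ + Ĥ_j ** Ŝ]`. -/
def G2 (H : Wave d → ℝ → CVec d) (S : Wave d → ℝ → ℂ) (j : Fin d) (k : Wave d) (p : ℝ) : ℂ :=
  -(fourierConv (fun q => D.u0 q j) (fun q => S q p) k
    + fourierConv (fun q => H q p j) D.Θ0 k
    + fourierLaplaceConv (fun q s => H q s j) S k p)

/-- The velocity component
`i k_j (π/z) ∫_0^{L₁} 𝒢(z,z') Ĝ_j^{[1]} dp' + a (π/z) ∫_0^{L₂} 𝒢(z,z') P_k[e Ŝ] dp' + 2 û₁ J₁(z)/z`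
with upper limits of integration `L₁`, `L₂`. -/
def velocityRHS (H : Wave d → ℝ → CVec d) (S : Wave d → ℝ → ℂ) (L₁ L₂ : ℝ)
    (k : Wave d) (p : ℝ) : CVec d :=
  (∑ j, (Complex.I * (k j : ℂ)) •
      ∫ p' in (0 : ℝ)..L₁, (borelKernel D.ν k p p' : ℂ) • G1 D H j k p')
    + (D.a : ℂ) •
      (∫ p' in (0 : ℝ)..L₂, (borelKernel D.ν k p p' : ℂ) • hodge k (scaleVec D.e (S k p')))
    + (borelSource D.ν k p : ℂ) • u1 D k

/-- The temperature component
`i k_j (π/ζ) ∫_0^{L₁} 𝒢(ζ,ζ') Ĝ_j^{[2]} dp' + 2 Θ̂₁ J₁(ζ)/ζ` with upper limit `L₁`. -/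
def temperatureRHS (H : Wave d → ℝ → CVec d) (S : Wave d → ℝ → ℂ) (L₁ : ℝ)
    (k : Wave d) (p : ℝ) : ℂ :=
  (∑ j, (Complex.I * (k j : ℂ)) *
      ∫ p' in (0 : ℝ)..L₁, (borelKernel D.μ k p p' : ℂ) * G2 D H S j k p')
    + (borelSource D.μ k p : ℂ) * Θ1 D k

/-- `(Ĥ, Ŝ)` solves the system of integral equations `(Ĥ, Ŝ) = 𝒩[(Ĥ, Ŝ)]` for `p ∈ (0, ∞)`, in
the class of functions for which `‖(Ĥ, Ŝ)(·, p)‖_N` is locally integrable on `[0, ∞)`. -/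
structure IsSolution (N : FourierNorm) (H : Wave d → ℝ → CVec d) (S : Wave d → ℝ → ℂ) :
    Prop where
  measurable_H : Measurable fun x : Wave d × ℝ => H x.1 x.2
  measurable_S : Measurable fun x : Wave d × ℝ => S x.1 x.2
  aemeasurable_norm :
    AEMeasurable (fun p => N.nrm fun k => pairAbs (H k p) (S k p)) (volume.restrict (Ioi 0))
  locallyIntegrable : ∀ L : ℝ,
    ∫⁻ p in Ioc 0 L, N.nrm (fun k => pairAbs (H k p) (S k p)) < ∞
  velocity_eq : ∀ᵐ p ∂(volume.restrict (Ioi (0 : ℝ))), ∀ k, H k p = velocityRHS D H S p p k p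
  temperature_eq : ∀ᵐ p ∂(volume.restrict (Ioi (0 : ℝ))), ∀ k, S k p = temperatureRHS D H S p k p

end Equations

/-! ### The functionals of the solution on `(0, p₀]` -/

/-- The known part `F^{(a)}`: equal to `F` for `p ∈ (0, p₀]` and to `0` otherwise. -/
def known {d : ℕ} {V : Type*} [Zero V] (p₀ : ℝ) (F : Wave d → ℝ → V) : Wave d → ℝ → V :=
  fun k => (Ioc 0 p₀).indicator (F k)

section Functionals

variable {d : ℕ} (N : FourierNorm) (D : Data d) (H : Wave d → ℝ → CVec d) (S : Wave d → ℝ → ℂ)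
  (p₀ : ℝ)

/-- `Ĥ^{(s)}`. -/
def Hs (k : Wave d) (p : ℝ) : CVec d :=
  velocityRHS D (known p₀ H) (known p₀ S) (min p (2 * p₀)) (min p p₀) k p

/-- `Ŝ^{(s)}`. -/
def Ss (k : Wave d) (p : ℝ) : ℂ :=
  temperatureRHS D (known p₀ H) (known p₀ S) (min p (2 * p₀)) k p

/-- `b = ω₀ ∫_{p₀}^∞ e^{-ω₀ p} ‖(Ĥ, Ŝ)^{(s)}(·, p)‖_N dp`. -/
def b (ω₀ : ℝ) : ℝ≥0∞ :=
  ENNReal.ofReal ω₀ * ∫⁻ p in Ioi p₀, ENNReal.ofReal (Real.exp (-ω₀ * p)) *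
    N.nrm fun k => pairAbs (Hs D H S p₀ k p) (Ss D H S p₀ k p)

/-- `ℬ₀(k) = C₀ sup_{p₀ ≤ p' ≤ p} π max(|𝒢(z,z')/z|, |𝒢(ζ,ζ')/ζ|)`. -/
def B0 (k : Wave d) : ℝ≥0∞ :=
  N.C0 d * ⨆ (p' : ℝ) (p : ℝ) (_ : p₀ ≤ p' ∧ p' ≤ p),
    max ‖borelKernel D.ν k p p'‖ₑ ‖borelKernel D.μ k p p'‖ₑ

/-- `ℬ₃ = sup_k |k| ℬ₀(k)`. -/
def B3 : ℝ≥0∞ := ⨆ k : Wave d, ‖k‖ₑ * B0 N D p₀ k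

/-- `ℬ₁ = 2 sup_k |k| ℬ₀(k) ‖(û₀, Θ̂₀)‖_N`. -/
def B1 : ℝ≥0∞ :=
  2 * (⨆ k : Wave d, ‖k‖ₑ * B0 N D p₀ k) * N.nrm fun k => pairAbs (D.u0 k) (D.Θ0 k)

/-- `ℬ₂(p) = 2 sup_k |k| ℬ₀(k) ‖(Ĥ, Ŝ)^{(a)}(·, p)‖_N`. -/
def B2 (p : ℝ) : ℝ≥0∞ :=
  2 * (⨆ k : Wave d, ‖k‖ₑ * B0 N D p₀ k) *
    N.nrm fun k => pairAbs (known p₀ H k p) (known p₀ S k p)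

/-- `ℬ₄ = a sup_k ℬ₀(k)`. -/
def B4 : ℝ≥0∞ := ENNReal.ofReal D.a * ⨆ k : Wave d, B0 N D p₀ k

/-- `ε₁ = ℬ₁ + ℬ₄ + ∫_0^{p₀} e^{-ω₀ p} ℬ₂(p) dp`. -/
def ε₁ (ω₀ : ℝ) : ℝ≥0∞ :=
  B1 N D p₀ + B4 N D p₀ +
    ∫⁻ p in Ioc 0 p₀, ENNReal.ofReal (Real.exp (-ω₀ * p)) * B2 N D H S p₀ p

end Functionals

end Boussinesq

end

/-!
Subtracting the part of the equation that only involves the solution on `(0, p₀]` leaves, for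
`p > p₀`, an integral equation over `[p₀, p]`, linear in the solution except for a Laplace
convolution of the solution on `(p₀, ∞)` with itself. The kernel is bounded because `√x J₁(2√x)`
and `√x Y₁(2√x)` solve `f'' = -f / x`, along which the energy `f'² + f² / x` decreases.
Since the norm is submultiplicative for `∗̂` up to the factor `C₀`, the function
`h(p) = ‖(Ĥ, Ŝ)(·, p)‖` then satisfies a quadratic Volterra inequality on `(p₀, ∞)`.

The weight `e^{-ωp}` is multiplicative for Laplace convolution, so the inequality becomes
`ω X ≤ b + ε₁ X + ℬ₃ X²` for the truncated integral `X(L) = ∫_{p₀}^L e^{-ωp} h(p) dp`. As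
`ω > ε₁ + 2 √(ℬ₃ b)`, the midpoint `(ω - ε₁) / (2 ℬ₃)` of the two roots is not a value of `X`;
`X` is continuous and starts at `0`, hence it stays below that midpoint.
-/

namespace Boussinesq

/-! ### Everywhere convergent power series -/

section PowerSeries

variable {𝕜 : Type*} [RCLike 𝕜] {c : ℕ → 𝕜}

/-- The power series with coefficients `c` converges absolutely on the whole field. -/
def EntireCoeff (c : ℕ → 𝕜) : Prop := ∀ r : ℝ, Summable fun n => ‖c n‖ * r ^ n

/-- The sum of the power series with coefficients `c`. -/
noncomputable def powerSum (c : ℕ → 𝕜) (x : 𝕜) : 𝕜 := ∑' n, c n * x ^ n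

/-- The coefficients of the derivative of the power series with coefficients `c`. -/
def derivCoeff (c : ℕ → 𝕜) (n : ℕ) : 𝕜 := (n + 1) * c (n + 1)

theorem powerSum_zero (c : ℕ → 𝕜) : powerSum c 0 = c 0 := by
  rw [powerSum, tsum_eq_single 0 fun n hn => by rw [zero_pow hn, mul_zero], pow_zero, mul_one]

theorem EntireCoeff.hasSum (hc : EntireCoeff c) (x : 𝕜) :
    HasSum (fun n => c n * x ^ n) (powerSum c x) :=
  (Summable.of_norm (by simpa only [norm_mul, norm_pow] using hc ‖x‖)).hasSum

theorem EntireCoeff.summable_nat_mul (hc : EntireCoeff c) {r : ℝ} (hr : 0 ≤ r) :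
    Summable fun n : ℕ => ‖c n‖ * (n * r ^ (n - 1)) := by
  refine Summable.of_nonneg_of_le (fun n => by positivity) (fun n => ?_) (hc (2 * (r + 1)))
  have hn : (n : ℝ) ≤ 2 ^ n := mod_cast n.lt_two_pow_self.le
  have hpow : r ^ (n - 1) ≤ (r + 1) ^ n :=
    (pow_le_pow_left₀ hr (by linarith) _).trans (pow_le_pow_right₀ (by linarith) n.pred_le)
  rw [mul_pow]
  gcongr

theorem EntireCoeff.derivCoeff (hc : EntireCoeff c) : EntireCoeff (derivCoeff c) := by
  intro r
  refine .of_norm_bounded ((summable_nat_add_iff 1).2 (hc.summable_nat_mul (abs_nonneg r)))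
    fun n => le_of_eq ?_
  have hn : ‖(n : 𝕜) + 1‖ = (n + 1 : ℕ) := by rw [← Nat.cast_succ, RCLike.norm_natCast]
  rw [Boussinesq.derivCoeff, norm_mul, norm_norm, norm_mul, norm_pow, hn, Real.norm_eq_abs,
    Nat.add_sub_cancel]
  ring

theorem EntireCoeff.hasDerivAt (hc : EntireCoeff c) (x : 𝕜) :
    HasDerivAt (powerSum c) (powerSum (Boussinesq.derivCoeff c) x) x := by
  have hbound (n : ℕ) {y : 𝕜} (hy : ‖y‖ ≤ ‖x‖ + 1) :
      ‖c n * (n * y ^ (n - 1))‖ ≤ ‖c n‖ * (n * (‖x‖ + 1) ^ (n - 1)) := by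
    rw [norm_mul, norm_mul, norm_pow, RCLike.norm_natCast]
    gcongr
  have hx : x ∈ Metric.ball (0 : 𝕜) (‖x‖ + 1) := by simp
  have hsum := hc.summable_nat_mul (r := ‖x‖ + 1) (by positivity)
  have hderiv : HasDerivAt (powerSum c) (∑' n : ℕ, c n * (n * x ^ (n - 1))) x :=
    hasDerivAt_tsum_of_isPreconnected hsum Metric.isOpen_ball
      (convex_ball (0 : 𝕜) (‖x‖ + 1)).isPreconnected
      (fun n y _ => (hasDerivAt_pow n y).const_mul (c n))
      (fun n y hy => hbound n (mem_ball_zero_iff.1 hy).le) hx (hc.hasSum x).summable hx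
  refine hderiv.congr_deriv ?_
  rw [(Summable.of_norm_bounded hsum fun n => hbound n (by linarith)).tsum_eq_zero_add, powerSum]
  simp only [Nat.cast_zero, zero_mul, mul_zero, zero_add, Nat.add_sub_cancel]
  exact tsum_congr fun n => by rw [Boussinesq.derivCoeff]; push_cast; ring

theorem EntireCoeff.hasSum_mul_derivCoeff (hc : EntireCoeff c) (x : 𝕜) :
    HasSum (fun n : ℕ => n * c n * x ^ n) (x * powerSum (Boussinesq.derivCoeff c) x) := by
  rw [← hasSum_nat_add_iff' 1]
  simp only [Finset.range_one, Finset.sum_singleton, Nat.cast_zero, zero_mul, sub_zero]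
  refine ((hc.derivCoeff.hasSum x).mul_left x).congr_fun fun n => ?_
  simp only [Boussinesq.derivCoeff]
  push_cast
  ring

theorem entireCoeff_of_norm_le {A B : ℝ} (hc : ∀ m, ‖c m‖ ≤ A * B ^ m / m.factorial) :
    EntireCoeff c := by
  intro r
  refine .of_norm_bounded ((Real.summable_pow_div_factorial (B * |r|)).mul_left A) fun n => ?_
  rw [norm_mul, norm_norm, norm_pow, Real.norm_eq_abs]
  calc ‖c n‖ * |r| ^ n ≤ A * B ^ n / n.factorial * |r| ^ n := by gcongr; exact hc n
    _ = A * ((B * |r|) ^ n / n.factorial) := by rw [mul_pow]; ring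

end PowerSeries

/-! ### The Bessel functions as power series -/

/-- The coefficients of `J₁(2√x)/√x`. -/
noncomputable def coeffJ (m : ℕ) : ℝ :=
  (-1 : ℝ) ^ m / ((m.factorial : ℝ) * ((m + 1).factorial : ℝ))

/-- The coefficients of the power series that enters the expansion of `Y₁`. -/
noncomputable def coeffY (m : ℕ) : ℝ :=
  ((harmonic m : ℝ) + (harmonic (m + 1) : ℝ) - 2 * Real.eulerMascheroniConstant) * coeffJ m

theorem coeffJ_zero : coeffJ 0 = 1 := by simp [coeffJ]

theorem coeffJ_succ (n : ℕ) : ((n : ℝ) + 1) * (n + 2) * coeffJ (n + 1) = -coeffJ n := by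
  have hn : (n.factorial : ℝ) ≠ 0 := mod_cast n.factorial_ne_zero
  simp only [coeffJ, Nat.factorial_succ]
  push_cast
  field_simp
  ring

theorem coeffY_succ (n : ℕ) :
    ((n : ℝ) + 1) * (n + 2) * coeffY (n + 1) = -coeffY n + (2 * n + 3) * coeffJ (n + 1) := by
  have hJ : coeffJ n = -(((n : ℝ) + 1) * (n + 2) * coeffJ (n + 1)) := by
    linarith [coeffJ_succ n]
  have hn : (n : ℝ) + 1 + 1 ≠ 0 := by positivity
  simp only [coeffY, harmonic_succ, hJ]
  push_cast
  field_simp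
  ring

theorem norm_coeffJ_le (m : ℕ) : ‖coeffJ m‖ ≤ 1 / m.factorial := by
  have h1 : (1 : ℝ) ≤ (m + 1).factorial := mod_cast Nat.factorial_pos _
  rw [coeffJ, norm_div, norm_pow, norm_neg, norm_one, one_pow, Real.norm_of_nonneg (by positivity)]
  gcongr
  exact le_mul_of_one_le_right (by positivity) h1

theorem harmonic_nonneg (m : ℕ) : 0 ≤ harmonic m := Finset.sum_nonneg fun _ _ => by positivity

theorem harmonic_le (m : ℕ) : harmonic m ≤ m := by
  refine (Finset.sum_le_card_nsmul _ _ 1 fun i _ => ?_).trans (by simp)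
  exact inv_le_one_of_one_le₀ (mod_cast i.succ_pos)

theorem norm_coeffY_le (m : ℕ) : ‖coeffY m‖ ≤ 4 * 2 ^ m / m.factorial := by
  have h0 : (0 : ℝ) ≤ harmonic m := mod_cast harmonic_nonneg m
  have h0' : (0 : ℝ) ≤ harmonic (m + 1) := mod_cast harmonic_nonneg (m + 1)
  have h1 : (harmonic m : ℝ) ≤ m := mod_cast harmonic_le m
  have h1' : (harmonic (m + 1) : ℝ) ≤ m + 1 := mod_cast harmonic_le (m + 1)
  have hγ := Real.eulerMascheroniConstant_lt_two_thirds
  have hγ' := Real.one_half_lt_eulerMascheroniConstant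
  have hm : (m : ℝ) + 1 ≤ 2 ^ m := mod_cast m.lt_two_pow_self
  rw [coeffY, norm_mul, div_eq_mul_one_div]
  gcongr
  · rw [Real.norm_eq_abs, abs_le]
    constructor <;> linarith
  · exact norm_coeffJ_le m

theorem entireCoeff_coeffJ : EntireCoeff coeffJ :=
  entireCoeff_of_norm_le (A := 1) (B := 1) fun m => by
    simpa only [one_pow, mul_one] using norm_coeffJ_le m

theorem entireCoeff_coeffY : EntireCoeff coeffY := entireCoeff_of_norm_le norm_coeffY_le

/-- `J₁(2√x)/√x`, extended analytically to the real line. -/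
noncomputable def seriesJ : ℝ → ℝ := powerSum coeffJ

/-- The part of `-π Y₁(2√x)/√x` that is analytic at `0` and free of `J₁`. -/
noncomputable def seriesY : ℝ → ℝ := powerSum coeffY

theorem seriesJ_zero : seriesJ 0 = 1 := (powerSum_zero _).trans coeffJ_zero

theorem hasDerivAt_seriesJ (x : ℝ) : HasDerivAt seriesJ (powerSum (derivCoeff coeffJ) x) x :=
  entireCoeff_coeffJ.hasDerivAt x

theorem hasDerivAt_seriesY (x : ℝ) : HasDerivAt seriesY (powerSum (derivCoeff coeffY) x) x :=
  entireCoeff_coeffY.hasDerivAt x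

theorem seriesJ_ode (x : ℝ) :
    x * powerSum (derivCoeff (derivCoeff coeffJ)) x + 2 * powerSum (derivCoeff coeffJ) x
      + seriesJ x = 0 := by
  have hsum := ((entireCoeff_coeffJ.derivCoeff.hasSum_mul_derivCoeff x).add
    ((entireCoeff_coeffJ.derivCoeff.hasSum x).mul_left 2)).add (entireCoeff_coeffJ.hasSum x)
  refine hsum.unique (hasSum_zero.congr_fun fun n => ?_)
  simp only [derivCoeff]
  linear_combination x ^ n * coeffJ_succ n

theorem seriesY_ode (x : ℝ) :
    x * (x * powerSum (derivCoeff (derivCoeff coeffY)) x + 2 * powerSum (derivCoeff coeffY) x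
      + seriesY x) = 2 * x * powerSum (derivCoeff coeffJ) x + seriesJ x - 1 := by
  have hY := (((entireCoeff_coeffY.derivCoeff.hasSum_mul_derivCoeff x).add
    ((entireCoeff_coeffY.derivCoeff.hasSum x).mul_left 2)).add
      (entireCoeff_coeffY.hasSum x)).mul_left x
  have hJ := ((entireCoeff_coeffJ.hasSum_mul_derivCoeff x).mul_left 2).add
    (entireCoeff_coeffJ.hasSum x)
  rw [← hasSum_nat_add_iff' 1] at hJ
  simp only [Finset.range_one, Finset.sum_singleton, coeffJ_zero] at hJ
  refine (hY.unique (hJ.congr_fun fun n => ?_)).trans (by rw [seriesJ]; simp [mul_assoc])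
  simp only [derivCoeff]
  push_cast
  linear_combination x ^ (n + 1) * coeffY_succ n

/-- The solution `√x J₁(2√x)` of `f'' = -f / x`. -/
noncomputable def solJ (x : ℝ) : ℝ := x * seriesJ x

/-- The solution `π √x Y₁(2√x)` of `f'' = -f / x`. -/
noncomputable def solY (x : ℝ) : ℝ := -1 + Real.log x * solJ x - x * seriesY x

/-- The derivative of `solJ`. -/
noncomputable def solJ' (x : ℝ) : ℝ := seriesJ x + x * powerSum (derivCoeff coeffJ) x

/-- The derivative of `solY`. -/
noncomputable def solY' (x : ℝ) : ℝ :=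
  seriesJ x + Real.log x * solJ' x - (seriesY x + x * powerSum (derivCoeff coeffY) x)

theorem hasDerivAt_solJ (x : ℝ) : HasDerivAt solJ (solJ' x) x :=
  ((hasDerivAt_id x).mul (hasDerivAt_seriesJ x)).congr_deriv (by rw [solJ', id, one_mul])

theorem hasDerivAt_solJ' {x : ℝ} (hx : 0 < x) : HasDerivAt solJ' (-solJ x / x) x := by
  have h := (hasDerivAt_seriesJ x).add
    ((hasDerivAt_id x).mul (entireCoeff_coeffJ.derivCoeff.hasDerivAt x))
  refine h.congr_deriv ?_
  simp only [solJ, id]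
  field_simp
  linear_combination seriesJ_ode x

theorem hasDerivAt_solY {x : ℝ} (hx : 0 < x) : HasDerivAt solY (solY' x) x := by
  have h := (((Real.hasDerivAt_log hx.ne').mul (hasDerivAt_solJ x)).const_add (-1)).sub
    ((hasDerivAt_id x).mul (hasDerivAt_seriesY x))
  refine h.congr_deriv ?_
  simp only [solY', solJ, id]
  field_simp

theorem hasDerivAt_solY' {x : ℝ} (hx : 0 < x) : HasDerivAt solY' (-solY x / x) x := by
  have h := ((hasDerivAt_seriesJ x).add
    ((Real.hasDerivAt_log hx.ne').mul (hasDerivAt_solJ' hx))).sub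
    ((hasDerivAt_seriesY x).add
      ((hasDerivAt_id x).mul (entireCoeff_coeffY.derivCoeff.hasDerivAt x)))
  refine h.congr_deriv ?_
  simp only [solY, solJ, solJ', id]
  field_simp
  linear_combination -seriesY_ode x

theorem besselJ1_two_mul {s : ℝ} (hs : 0 < s) : besselJ1 (2 * s) = solJ (s ^ 2) / s := by
  have hfactor : solJ (s ^ 2) / s = s * ∑' n, coeffJ n * (s ^ 2) ^ n := by
    rw [solJ, seriesJ, powerSum]
    field_simp
  rw [besselJ1, hfactor, ← tsum_mul_left]
  refine tsum_congr fun n => ?_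
  rw [coeffJ, mul_div_cancel_left₀ _ (two_ne_zero), ← pow_mul]
  ring

theorem besselY1_two_mul {s : ℝ} (hs : 0 < s) :
    besselY1 (2 * s) = solY (s ^ 2) / (Real.pi * s) := by
  have hseries : ∑' m : ℕ, ((harmonic m : ℝ) + (harmonic (m + 1) : ℝ)
      - 2 * Real.eulerMascheroniConstant) * ((-1 : ℝ) ^ m / ((m.factorial : ℝ) *
        ((m + 1).factorial : ℝ))) * s ^ (2 * m + 1) = s * seriesY (s ^ 2) := by
    rw [seriesY, powerSum, ← tsum_mul_left]
    refine tsum_congr fun n => ?_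
    rw [coeffY, coeffJ, ← pow_mul]
    ring
  rw [besselY1, besselJ1_two_mul hs, mul_div_cancel_left₀ _ (two_ne_zero), solY, Real.log_pow,
    hseries]
  push_cast
  field_simp

/-! ### The kernel and the energy method -/

/-- The solution of `f'' = -f / x` that vanishes at `x'` with derivative `1`. -/
noncomputable def fundSol (x x' : ℝ) : ℝ := solY x * solJ x' - solJ x * solY x'

/-- The derivative of `fundSol` in its first argument. -/
noncomputable def fundSol' (x x' : ℝ) : ℝ := solY' x * solJ x' - solJ' x * solY x'

theorem fundSol_self (x : ℝ) : fundSol x x = 0 := by rw [fundSol]; ring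

theorem hasDerivAt_fundSol {x : ℝ} (hx : 0 < x) (x' : ℝ) :
    HasDerivAt (fun y => fundSol y x') (fundSol' x x') x :=
  ((hasDerivAt_solY hx).mul_const _).sub ((hasDerivAt_solJ x).mul_const _)

theorem hasDerivAt_fundSol' {x : ℝ} (hx : 0 < x) (x' : ℝ) :
    HasDerivAt (fun y => fundSol' y x') (-fundSol x x' / x) x :=
  (((hasDerivAt_solY' hx).mul_const (solJ x')).sub
    ((hasDerivAt_solJ' hx).mul_const (solY x'))).congr_deriv (by rw [fundSol]; ring)

theorem continuous_fundSol'_self : Continuous fun x => fundSol' x x := by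
  have hJ : Continuous seriesJ :=
    continuous_iff_continuousAt.2 fun x => (hasDerivAt_seriesJ x).continuousAt
  have hY : Continuous seriesY :=
    continuous_iff_continuousAt.2 fun x => (hasDerivAt_seriesY x).continuousAt
  have hJ' : Continuous (powerSum (derivCoeff coeffJ)) := continuous_iff_continuousAt.2 fun x =>
    (entireCoeff_coeffJ.derivCoeff.hasDerivAt x).continuousAt
  have hY' : Continuous (powerSum (derivCoeff coeffY)) := continuous_iff_continuousAt.2 fun x =>
    (entireCoeff_coeffY.derivCoeff.hasDerivAt x).continuousAt
  have hlog_free (x : ℝ) : fundSol' x x =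
      x * seriesJ x * (seriesJ x - (seriesY x + x * powerSum (derivCoeff coeffY) x))
        + (seriesJ x + x * powerSum (derivCoeff coeffJ) x) * (1 + x * seriesY x) := by
    simp only [fundSol', solY', solY, solJ', solJ]
    ring
  simp only [hlog_free]
  fun_prop

/-- The Wronskian of the two solutions is constant, and its value is read off at `0`, where the
logarithms cancel. -/
theorem fundSol'_self {x : ℝ} (hx : 0 < x) : fundSol' x x = 1 := by
  have hderiv : ∀ y ∈ Ioo 0 x, HasDerivAt (fun y => fundSol' y y) 0 y := fun y hy =>
    (((hasDerivAt_solY' hy.1).mul (hasDerivAt_solJ y)).sub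
      ((hasDerivAt_solJ' hy.1).mul (hasDerivAt_solY hy.1))).congr_deriv (by ring)
  have hzero : fundSol' 0 0 = 1 := by
    simp [fundSol', solJ', solJ, solY, seriesJ_zero]
  obtain ⟨y, -, hy⟩ := exists_hasDerivAt_eq_slope (fun y => fundSol' y y) (fun _ => 0) hx
    continuous_fundSol'_self.continuousOn hderiv
  rw [eq_comm, div_eq_zero_iff, sub_zero, or_iff_left hx.ne', sub_eq_zero] at hy
  exact hy.trans hzero

theorem fundSol_energy_antitoneOn (x' : ℝ) :
    AntitoneOn (fun x => fundSol' x x' ^ 2 + fundSol x x' ^ 2 / x) (Ioi 0) := by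
  have hderiv : ∀ x ∈ Ioi (0 : ℝ), HasDerivAt (fun x => fundSol' x x' ^ 2 + fundSol x x' ^ 2 / x)
      (-(fundSol x x' / x) ^ 2) x := fun x hx => by
    have hx0 : x ≠ 0 := (mem_Ioi.1 hx).ne'
    refine (((hasDerivAt_fundSol' hx x').pow 2).add
      (((hasDerivAt_fundSol hx x').pow 2).div (hasDerivAt_id x) hx0)).congr_deriv ?_
    simp only [id, Nat.cast_ofNat, Nat.add_one_sub_one, pow_one, Pi.pow_apply]
    field_simp
    ring
  rw [← interior_Ioi] at hderiv
  exact antitoneOn_of_hasDerivWithinAt_nonpos (convex_Ioi 0)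
    (fun x hx => (hderiv x (by rwa [interior_Ioi])).continuousAt.continuousWithinAt)
    (fun x hx => (hderiv x hx).hasDerivWithinAt)
    (fun x _ => neg_nonpos.2 (sq_nonneg _))

section Bounds

variable {x x' : ℝ}

theorem fundSol_energy_le (hx' : 0 < x') (h : x' ≤ x) :
    fundSol' x x' ^ 2 + fundSol x x' ^ 2 / x ≤ 1 := by
  have hle := fundSol_energy_antitoneOn x' hx' (hx'.trans_le h) h
  simpa only [fundSol_self, fundSol'_self hx', one_pow, ne_eq, two_ne_zero, not_false_eq_true,
    zero_pow, zero_div, add_zero] using hle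

theorem abs_fundSol_le_sqrt (hx' : 0 < x') (h : x' ≤ x) : |fundSol x x'| ≤ √x := by
  have hx : 0 < x := hx'.trans_le h
  refine Real.abs_le_sqrt ?_
  rw [← div_le_one hx]
  linarith [fundSol_energy_le hx' h, sq_nonneg (fundSol' x x')]

theorem abs_fundSol'_le_one (hx' : 0 < x') (h : x' ≤ x) : |fundSol' x x'| ≤ 1 := by
  have hx : 0 < x := hx'.trans_le h
  rw [← sq_le_one_iff_abs_le_one]
  have : 0 ≤ fundSol x x' ^ 2 / x := by positivity
  linarith [fundSol_energy_le hx' h]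

theorem abs_fundSol_le (hx' : 0 < x') (h : x' ≤ x) : |fundSol x x'| ≤ x := by
  have hmvt := (convex_Icc x' x).norm_image_sub_le_of_norm_hasDerivWithin_le
    (f := fun y => fundSol y x')
    (fun y hy => (hasDerivAt_fundSol (hx'.trans_le hy.1) x').hasDerivWithinAt)
    (fun y hy => abs_fundSol'_le_one hx' hy.1) (left_mem_Icc.2 h) (right_mem_Icc.2 h)
  rw [fundSol_self, sub_zero, one_mul, Real.norm_eq_abs, Real.norm_eq_abs,
    abs_of_nonneg (sub_nonneg.2 h)] at hmvt
  linarith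

theorem eventually_fundSol_ne_zero (hx' : 0 < x') :
    ∀ᶠ x in nhdsWithin x' (Ioi x'), fundSol x x' ≠ 0 := by
  have hderiv := hasDerivAt_fundSol hx' x'
  rw [fundSol'_self hx'] at hderiv
  exact (hderiv.eventually_ne one_ne_zero).filter_mono
    (nhdsWithin_mono _ fun _ hx => (mem_Ioi.1 hx).ne')

end Bounds

section Kernel

variable {d : ℕ} {κ : ℝ} {k : Wave d} {p₀ p p' : ℝ}

theorem borelKernel_eq_fundSol_div (hκ : 0 < κ) (hk : k ≠ 0) (hp : 0 < p) (hp' : 0 < p') :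
    borelKernel κ k p p' = fundSol (κ * ‖k‖ ^ 2 * p) (κ * ‖k‖ ^ 2 * p') / (κ * ‖k‖ ^ 2 * p) := by
  have : 0 < ‖k‖ := norm_pos_iff.2 hk
  have hsq (q : ℝ) (hq : 0 < q) : κ * ‖k‖ ^ 2 * q = (‖k‖ * √(κ * q)) ^ 2 := by
    rw [mul_pow, Real.sq_sqrt (by positivity)]
    ring
  have hs : 0 < ‖k‖ * √(κ * p) := by positivity
  have hs' : 0 < ‖k‖ * √(κ * p') := by positivity
  rw [borelKernel, if_neg hk, kernelG, zVar, zVar, mul_assoc 2 ‖k‖, mul_assoc 2 ‖k‖,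
    besselJ1_two_mul hs, besselJ1_two_mul hs', besselY1_two_mul hs, besselY1_two_mul hs',
    hsq p hp, hsq p' hp', fundSol]
  field_simp
  ring

theorem abs_borelKernel_le_one (hκ : 0 < κ) (k : Wave d) (hp' : 0 < p') (h : p' ≤ p) :
    |borelKernel κ k p p'| ≤ 1 := by
  have hp : 0 < p := hp'.trans_le h
  by_cases hk : k = 0
  · have hle : p' / p ≤ 1 := (div_le_one hp).2 h
    have hpos : 0 < p' / p := by positivity
    rw [borelKernel, if_pos hk, abs_le]
    constructor <;> linarith
  · have : 0 < ‖k‖ := norm_pos_iff.2 hk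
    rw [borelKernel_eq_fundSol_div hκ hk hp hp', abs_div,
      abs_of_pos (a := κ * ‖k‖ ^ 2 * p) (by positivity)]
    exact div_le_one_of_le₀ (abs_fundSol_le (by positivity) (by gcongr)) (by positivity)

theorem norm_mul_abs_borelKernel_le (hκ : 0 < κ) (k : Wave d) (hp₀ : 0 < p₀) (hp' : p₀ ≤ p')
    (h : p' ≤ p) : ‖k‖ * |borelKernel κ k p p'| ≤ 1 / √(κ * p₀) := by
  have hp'0 : 0 < p' := hp₀.trans_le hp'
  have hp : 0 < p := hp'0.trans_le h
  by_cases hk : k = 0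
  · rw [hk, norm_zero, zero_mul]
    positivity
  · have : 0 < ‖k‖ := norm_pos_iff.2 hk
    have hsq : κ * ‖k‖ ^ 2 * p = (‖k‖ * √(κ * p)) ^ 2 := by
      rw [mul_pow, Real.sq_sqrt (by positivity)]
      ring
    have hsqrt : √(κ * ‖k‖ ^ 2 * p) = ‖k‖ * √(κ * p) := by
      rw [hsq, Real.sqrt_sq (by positivity)]
    rw [borelKernel_eq_fundSol_div hκ hk hp hp'0, abs_div,
      abs_of_pos (a := κ * ‖k‖ ^ 2 * p) (by positivity)]
    calc ‖k‖ * (|fundSol (κ * ‖k‖ ^ 2 * p) (κ * ‖k‖ ^ 2 * p')| / (κ * ‖k‖ ^ 2 * p))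
        ≤ ‖k‖ * (√(κ * ‖k‖ ^ 2 * p) / (κ * ‖k‖ ^ 2 * p)) := by
          gcongr
          exact abs_fundSol_le_sqrt (by positivity) (by gcongr)
      _ = 1 / √(κ * p) := by
          rw [hsqrt, hsq]
          field_simp
      _ ≤ 1 / √(κ * p₀) := by
          gcongr
          exact hp'.trans h

theorem continuousOn_borelKernel (hκ : 0 < κ) (k : Wave d) (hp : 0 < p) :
    ContinuousOn (borelKernel κ k p) (Ioi 0) := by
  by_cases hk : k = 0
  · have : Continuous fun p' : ℝ => 1 - p' / p := by fun_prop
    exact this.continuousOn.congr fun p' _ => by rw [borelKernel, if_pos hk]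
  · have : 0 < ‖k‖ := norm_pos_iff.2 hk
    refine ContinuousOn.congr (fun q hq => ?_)
      fun q hq => borelKernel_eq_fundSol_div hκ hk hp (mem_Ioi.1 hq)
    have hq0 : 0 < κ * ‖k‖ ^ 2 * q := mul_pos (by positivity) hq
    have hscale : ContinuousAt (fun q : ℝ => κ * ‖k‖ ^ 2 * q) q := by fun_prop
    have hJ := (hasDerivAt_solJ (κ * ‖k‖ ^ 2 * q)).continuousAt.comp hscale
    have hY := (hasDerivAt_solY hq0).continuousAt.comp hscale
    exact (((hJ.const_mul _).sub (hY.const_mul _)).div_const _).continuousWithinAt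

theorem exists_borelKernel_ne_zero (hκ : 0 < κ) (hk : k ≠ 0) (hp₀ : 0 < p₀) :
    ∃ p, p₀ ≤ p ∧ borelKernel κ k p p₀ ≠ 0 := by
  have : 0 < ‖k‖ := norm_pos_iff.2 hk
  have hx₀ : 0 < κ * ‖k‖ ^ 2 * p₀ := by positivity
  obtain ⟨x, hne, hx⟩ :=
    ((eventually_fundSol_ne_zero hx₀).and self_mem_nhdsWithin).exists
  have hxp : κ * ‖k‖ ^ 2 * (x / (κ * ‖k‖ ^ 2)) = x := by field_simp
  have hle : p₀ ≤ x / (κ * ‖k‖ ^ 2) := by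
    rw [le_div_iff₀' (by positivity)]
    exact (mem_Ioi.1 hx).le
  refine ⟨_, hle, ?_⟩
  rw [borelKernel_eq_fundSol_div hκ hk (hp₀.trans_le hle) hp₀, hxp]
  exact div_ne_zero hne (hx₀.trans hx).ne'

end Kernel

/-! ### Convolution of nonnegative functions -/

section LConvolution

variable {G : Type*} [MeasurableSpace G] {m : Measure G}

theorem lconvolution_mono [Add G] [Neg G] {f f' g g' : G → ℝ≥0∞} (hf : f ≤ f') (hg : g ≤ g') :
    f ⋆ₗ[m] g ≤ f' ⋆ₗ[m] g' :=
  fun _ => lintegral_mono fun y => mul_le_mul' (hf y) (hg _)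

theorem lconvolution_le_lintegral_mul_iSup [Add G] [Neg G] {f : G → ℝ≥0∞} (hf : Measurable f)
    (g : G → ℝ≥0∞) (x : G) : (f ⋆ₗ[m] g) x ≤ (∫⁻ y, f y ∂m) * ⨆ y, g y := by
  rw [← lintegral_mul_const _ hf]
  exact lintegral_mono fun y => mul_le_mul_right (le_iSup g _) _

theorem lintegral_lconvolution [AddGroup G] [MeasurableAdd₂ G] [MeasurableNeg G]
    [m.IsAddLeftInvariant] [SFinite m] {f g : G → ℝ≥0∞} (hf : Measurable f) (hg : Measurable g) :
    ∫⁻ x, (f ⋆ₗ[m] g) x ∂m = (∫⁻ y, f y ∂m) * ∫⁻ y, g y ∂m := by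
  simp only [lconvolution_def]
  rw [lintegral_lintegral_swap (by fun_prop), ← lintegral_mul_const _ hf]
  refine lintegral_congr fun y => ?_
  rw [lintegral_const_mul _ (by fun_prop), lintegral_add_left_eq_self g (-y)]

end LConvolution

/-! ### The norms in the wave vector -/

namespace FourierNorm

variable {d : ℕ}

/-- The weight `(1 + |k|)^γ e^{β|k|}` of the norm `‖·‖_{γ,β}`. -/
noncomputable def weight (γ β : ℝ) (k : Wave d) : ℝ≥0∞ :=
  ENNReal.ofReal ((1 + ‖k‖) ^ γ * Real.exp (β * ‖k‖))

/-- `‖·‖_N` of a nonnegative function of `k`; in contrast to `FourierNorm.nrm`, the function may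
take the value `∞`. -/
noncomputable def enrm (N : FourierNorm) (g : Wave d → ℝ≥0∞) : ℝ≥0∞ :=
  match N with
  | .weighted γ β => ⨆ k, weight γ β k * g k
  | .l1linf => max (∫⁻ k, g k) (⨆ k, g k)

variable {N : FourierNorm} {f g : Wave d → ℝ≥0∞}

theorem nrm_eq_enrm (N : FourierNorm) (g : Wave d → ℝ) : N.nrm g = N.enrm fun k => ‖g k‖ₑ := by
  cases N <;> rfl

theorem weight_mul_le_enrm (γ β : ℝ) (g : Wave d → ℝ≥0∞) (k : Wave d) :
    weight γ β k * g k ≤ (weighted γ β).enrm g :=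
  le_iSup (fun k => weight γ β k * g k) k

theorem enrm_mono (h : f ≤ g) : N.enrm f ≤ N.enrm g := by
  cases N with
  | weighted γ β => exact iSup_mono fun k => mul_le_mul_right (h k) _
  | l1linf => exact max_le_max (lintegral_mono h) (iSup_mono h)

theorem enrm_zero : N.enrm (fun _ : Wave d => 0) = 0 := by
  cases N <;> simp [enrm]

theorem enrm_add_le (f : Wave d → ℝ≥0∞) (hg : Measurable g) :
    N.enrm (f + g) ≤ N.enrm f + N.enrm g := by
  cases N with
  | weighted γ β =>
    refine iSup_le fun k => ?_
    rw [Pi.add_apply, mul_add]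
    exact add_le_add (weight_mul_le_enrm γ β f k) (weight_mul_le_enrm γ β g k)
  | l1linf =>
    refine max_le ?_ (iSup_le fun k => ?_)
    · simp only [Pi.add_apply]
      rw [lintegral_add_right _ hg]
      exact add_le_add (le_max_left _ _) (le_max_left _ _)
    · exact add_le_add (le_max_of_le_right (le_iSup f k)) (le_max_of_le_right (le_iSup g k))

theorem enrm_add_le_of_le {x y : ℝ≥0∞} (hg : Measurable g) (hf : N.enrm f ≤ x)
    (hg' : N.enrm g ≤ y) : N.enrm (f + g) ≤ x + y :=
  (enrm_add_le f hg).trans (add_le_add hf hg')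

theorem enrm_const_mul_le (c : ℝ≥0∞) (hg : Measurable g) :
    N.enrm (fun k => c * g k) ≤ c * N.enrm g := by
  cases N with
  | weighted γ β =>
    refine iSup_le fun k => ?_
    rw [mul_left_comm]
    exact mul_le_mul_right (weight_mul_le_enrm γ β g k) c
  | l1linf =>
    refine max_le ?_ (iSup_le fun k => ?_)
    · rw [lintegral_const_mul _ hg]
      exact mul_le_mul_right (le_max_left _ _) c
    · exact mul_le_mul_right (le_max_of_le_right (le_iSup g k)) c

theorem enrm_lintegral_le {α : Type*} [MeasurableSpace α] (m : Measure α) [SFinite m]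
    {F : Wave d → α → ℝ≥0∞} (hF : Measurable (Function.uncurry F)) :
    N.enrm (fun k => ∫⁻ s, F k s ∂m) ≤ ∫⁻ s, N.enrm (fun k => F k s) ∂m := by
  cases N with
  | weighted γ β =>
    refine iSup_le fun k => ?_
    rw [weight, ← lintegral_const_mul' _ _ ENNReal.ofReal_ne_top]
    exact lintegral_mono fun s => weight_mul_le_enrm γ β (F · s) k
  | l1linf =>
    refine max_le ?_ (iSup_le fun k => ?_)
    · rw [lintegral_lintegral_swap hF.aemeasurable]
      exact lintegral_mono fun s => le_max_left _ _
    · exact lintegral_mono fun s => le_max_of_le_right (le_iSup (F · s) k)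

theorem le_enrm (hN : N.Admissible d) (g : Wave d → ℝ≥0∞) (k : Wave d) : g k ≤ N.enrm g := by
  cases N with
  | weighted γ β =>
    have hγ : 0 ≤ γ := (Nat.cast_nonneg d).trans hN.1.le
    have hβ : 0 ≤ β := hN.2
    refine (le_mul_of_one_le_left zero_le ?_).trans (weight_mul_le_enrm γ β g k)
    rw [weight, ENNReal.one_le_ofReal]
    exact one_le_mul_of_one_le_of_one_le (Real.one_le_rpow (by linarith [norm_nonneg k]) hγ)
      (Real.one_le_exp (by positivity))
  | l1linf => exact le_max_of_le_right (le_iSup g k)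

theorem one_add_rpow_le {γ x y z : ℝ} (hγ : 0 ≤ γ) (hx : 0 ≤ x) (hy : 0 ≤ y) (hz : 0 ≤ z)
    (h : x ≤ y + z) : (1 + x) ^ γ ≤ 2 ^ γ * ((1 + y) ^ γ + (1 + z) ^ γ) := by
  have hmax : (1 + max y z) ^ γ ≤ (1 + y) ^ γ + (1 + z) ^ γ := by
    rcases le_total y z with hyz | hzy
    · rw [max_eq_right hyz]
      exact le_add_of_nonneg_left (by positivity)
    · rw [max_eq_left hzy]
      exact le_add_of_nonneg_right (by positivity)
  calc (1 + x) ^ γ ≤ (2 * (1 + max y z)) ^ γ :=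
        Real.rpow_le_rpow (by positivity)
          (by linarith [le_max_left y z, le_max_right y z]) hγ
    _ = 2 ^ γ * (1 + max y z) ^ γ := Real.mul_rpow two_pos.le (by positivity)
    _ ≤ 2 ^ γ * ((1 + y) ^ γ + (1 + z) ^ γ) := by gcongr

theorem weight_le {γ β : ℝ} (hγ : 0 ≤ γ) (hβ : 0 ≤ β) (k q : Wave d) :
    weight γ β k ≤ ENNReal.ofReal (2 ^ γ) * (ENNReal.ofReal ((1 + ‖q‖) ^ (-γ))
      + ENNReal.ofReal ((1 + ‖-q + k‖) ^ (-γ))) * (weight γ β q * weight γ β (-q + k)) := by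
  have htri : ‖k‖ ≤ ‖q‖ + ‖-q + k‖ := by simpa using norm_add_le q (-q + k)
  have hexp : Real.exp (β * ‖k‖) ≤ Real.exp (β * ‖q‖) * Real.exp (β * ‖-q + k‖) := by
    rw [← Real.exp_add, ← mul_add]
    gcongr
  have hinv (v : Wave d) : (1 + ‖v‖) ^ γ * (1 + ‖v‖) ^ (-γ) = 1 := by
    rw [← Real.rpow_add (by positivity), add_neg_cancel, Real.rpow_zero]
  simp only [weight]
  rw [← ENNReal.ofReal_add (by positivity) (by positivity), ← ENNReal.ofReal_mul (by positivity),
    ← ENNReal.ofReal_mul (by positivity), ← ENNReal.ofReal_mul (by positivity)]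
  refine ENNReal.ofReal_le_ofReal ?_
  calc (1 + ‖k‖) ^ γ * Real.exp (β * ‖k‖)
      ≤ 2 ^ γ * ((1 + ‖q‖) ^ γ + (1 + ‖-q + k‖) ^ γ)
          * (Real.exp (β * ‖q‖) * Real.exp (β * ‖-q + k‖)) := by
        gcongr
        exact one_add_rpow_le hγ (norm_nonneg k) (norm_nonneg q) (norm_nonneg _) htri
    _ = 2 ^ γ * ((1 + ‖q‖) ^ (-γ) + (1 + ‖-q + k‖) ^ (-γ))
          * ((1 + ‖q‖) ^ γ * Real.exp (β * ‖q‖)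
            * ((1 + ‖-q + k‖) ^ γ * Real.exp (β * ‖-q + k‖))) := by
        linear_combination (-(2 : ℝ) ^ γ * Real.exp (β * ‖q‖) * Real.exp (β * ‖-q + k‖))
          * ((1 + ‖-q + k‖) ^ γ * hinv q + (1 + ‖q‖) ^ γ * hinv (-q + k))

theorem weight_mul_lconvolution_le {γ β : ℝ} (hγ : 0 ≤ γ) (hβ : 0 ≤ β) (f g : Wave d → ℝ≥0∞)
    (k : Wave d) : weight γ β k * (f ⋆ₗ g) k ≤
      (weighted γ β).C0 d * ((weighted γ β).enrm f * (weighted γ β).enrm g) := by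
  set φ : Wave d → ℝ≥0∞ := fun q => ENNReal.ofReal ((1 + ‖q‖) ^ (-γ))
  have hφm : Measurable φ := by fun_prop
  calc weight γ β k * (f ⋆ₗ g) k
      = ∫⁻ q, weight γ β k * (f q * g (-q + k)) := by
        rw [lconvolution_def, weight, lintegral_const_mul' _ _ ENNReal.ofReal_ne_top]
    _ ≤ ∫⁻ q, ENNReal.ofReal (2 ^ γ) * (φ q + φ (-q + k))
          * ((weighted γ β).enrm f * (weighted γ β).enrm g) := by
        refine lintegral_mono fun q => (mul_le_mul_left (weight_le hγ hβ k q) _).trans ?_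
        rw [mul_assoc, mul_mul_mul_comm (weight γ β q)]
        exact mul_le_mul_right (mul_le_mul' (weight_mul_le_enrm γ β f q)
          (weight_mul_le_enrm γ β g (-q + k))) _
    _ = ENNReal.ofReal (2 ^ γ) * ((∫⁻ q, φ q) + ∫⁻ q, φ q)
          * ((weighted γ β).enrm f * (weighted γ β).enrm g) := by
        have hshift : ∫⁻ q, φ (-q + k) = ∫⁻ q, φ q := by
          simp only [neg_add_eq_sub]
          exact lintegral_sub_left_eq_self φ k
        rw [lintegral_mul_const _ (by fun_prop), lintegral_const_mul _ (by fun_prop),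
          lintegral_add_left hφm, hshift]
    _ = (weighted γ β).C0 d * ((weighted γ β).enrm f * (weighted γ β).enrm g) := by
        rw [C0, Real.rpow_add two_pos, Real.rpow_one, ENNReal.ofReal_mul (by positivity),
          ENNReal.ofReal_ofNat, ← two_mul]
        ring

theorem enrm_lconvolution_le (hN : N.Admissible d) (hf : Measurable f) (hg : Measurable g) :
    N.enrm (f ⋆ₗ g) ≤ N.C0 d * (N.enrm f * N.enrm g) := by
  cases N with
  | weighted γ β =>
    exact iSup_le (weight_mul_lconvolution_le ((Nat.cast_nonneg d).trans hN.1.le) hN.2 f g)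
  | l1linf =>
    rw [C0, one_mul]
    refine max_le ?_ (iSup_le fun k => ?_)
    · rw [lintegral_lconvolution hf hg]
      exact mul_le_mul' (le_max_left _ _) (le_max_left _ _)
    · exact (lconvolution_le_lintegral_mul_iSup hf g k).trans
        (mul_le_mul' (le_max_left _ _) (le_max_right _ _))

theorem C0_lt_top (hN : N.Admissible d) : N.C0 d < ∞ := by
  cases N with
  | l1linf => exact ENNReal.one_lt_top
  | weighted γ β =>
    refine ENNReal.mul_lt_top ENNReal.ofReal_lt_top (finite_integral_one_add_norm ?_)
    simpa using hN.1

/-- The unit ball, of volume `π` or `4π/3`, already contributes more than `1` to the integral. -/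
theorem one_le_C0 (hd : d = 2 ∨ d = 3) (hN : N.Admissible d) : 1 ≤ N.C0 d := by
  cases N with
  | l1linf => exact le_rfl
  | weighted γ β =>
    have hγ : 0 ≤ γ := (Nat.cast_nonneg d).trans hN.1.le
    have hvol : 1 ≤ volume (Metric.ball (0 : Wave d) 1) := by
      have hpi := Real.pi_gt_three
      rcases hd with rfl | rfl
      · rw [EuclideanSpace.volume_ball_fin_two, ENNReal.ofReal_one, one_pow, one_mul,
          ENNReal.one_le_ofReal]
        linarith
      · rw [EuclideanSpace.volume_ball_fin_three, ENNReal.ofReal_one, one_pow, one_mul,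
          ENNReal.one_le_ofReal]
        linarith
    calc (1 : ℝ≥0∞) ≤ 2 * volume (Metric.ball (0 : Wave d) 1) :=
          hvol.trans (le_mul_of_one_le_left zero_le one_le_two)
      _ = ENNReal.ofReal (2 ^ (γ + 1)) *
            ∫⁻ _ in Metric.ball (0 : Wave d) 1, ENNReal.ofReal (2 ^ (-γ)) := by
          rw [setLIntegral_const, ← mul_assoc, ← ENNReal.ofReal_mul (by positivity),
            ← Real.rpow_add two_pos, add_neg_cancel_comm, Real.rpow_one, ENNReal.ofReal_ofNat]
      _ ≤ (weighted γ β).C0 d := by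
          refine mul_le_mul_right ((setLIntegral_mono' measurableSet_ball fun k hk => ?_).trans
            (setLIntegral_le_lintegral _ _)) _
          refine ENNReal.ofReal_le_ofReal
            (Real.rpow_le_rpow_of_nonpos (by positivity) ?_ (neg_nonpos.2 hγ))
          linarith [mem_ball_zero_iff.1 hk]

end FourierNorm

/-! ### The kernel constants -/

section KernelConstants

variable {d : ℕ} {N : FourierNorm} {D : Data d} {p₀ : ℝ}

/-- The supremum over `p₀ ≤ p' ≤ p` of the two kernels, so that `ℬ₀(k) = C₀ kernelSup k`. -/
noncomputable def kernelSup (D : Data d) (p₀ : ℝ) (k : Wave d) : ℝ≥0∞ :=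
  ⨆ (p' : ℝ) (p : ℝ) (_ : p₀ ≤ p' ∧ p' ≤ p),
    max ‖borelKernel D.ν k p p'‖ₑ ‖borelKernel D.μ k p p'‖ₑ

theorem le_kernelSup (D : Data d) (k : Wave d) {p p' : ℝ} (h₀ : p₀ ≤ p') (h : p' ≤ p) :
    max ‖borelKernel D.ν k p p'‖ₑ ‖borelKernel D.μ k p p'‖ₑ ≤ kernelSup D p₀ k :=
  le_iSup_of_le p' (le_iSup_of_le p (le_iSup_of_le ⟨h₀, h⟩ le_rfl))

theorem B3_eq (N : FourierNorm) (D : Data d) (p₀ : ℝ) :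
    B3 N D p₀ = N.C0 d * ⨆ k, ‖k‖ₑ * kernelSup D p₀ k := by
  simp only [B3, ENNReal.mul_iSup]
  exact iSup_congr fun k => mul_left_comm _ _ _

theorem B4_eq (N : FourierNorm) (D : Data d) (p₀ : ℝ) :
    B4 N D p₀ = ENNReal.ofReal D.a * (N.C0 d * ⨆ k, kernelSup D p₀ k) := by
  simp only [B4, ENNReal.mul_iSup]
  rfl

theorem enorm_mul_enorm_borelKernel_le {κ : ℝ} (hκ : 0 < κ) (k : Wave d) {p p' : ℝ}
    (hp₀ : 0 < p₀) (hp' : p₀ ≤ p') (h : p' ≤ p) :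
    ‖k‖ₑ * ‖borelKernel κ k p p'‖ₑ ≤ ENNReal.ofReal (1 / √(κ * p₀)) := by
  rw [← enorm_norm k, ← enorm_mul, Real.enorm_eq_ofReal_abs, abs_mul, abs_norm]
  exact ENNReal.ofReal_le_ofReal (norm_mul_abs_borelKernel_le hκ k hp₀ hp' h)

theorem B3_lt_top (hN : N.Admissible d) (hν : 0 < D.ν) (hμ : 0 < D.μ) (hp₀ : 0 < p₀) :
    B3 N D p₀ < ∞ := by
  rw [B3_eq]
  refine ENNReal.mul_lt_top (FourierNorm.C0_lt_top hN) (lt_of_le_of_lt (iSup_le fun k => ?_)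
    (max_lt (ENNReal.ofReal_lt_top (r := 1 / √(D.ν * p₀)))
      (ENNReal.ofReal_lt_top (r := 1 / √(D.μ * p₀)))))
  simp only [kernelSup, ENNReal.mul_iSup, mul_max]
  exact iSup_le fun p' => iSup_le fun p => iSup_le fun h => max_le_max
    (enorm_mul_enorm_borelKernel_le hν k hp₀ h.1 h.2)
    (enorm_mul_enorm_borelKernel_le hμ k hp₀ h.1 h.2)

theorem B3_ne_zero (hC0 : N.C0 d ≠ 0) (hν : 0 < D.ν) (hp₀ : 0 < p₀) {k : Wave d} (hk : k ≠ 0) :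
    B3 N D p₀ ≠ 0 := by
  obtain ⟨p, hp, hne⟩ := exists_borelKernel_ne_zero hν hk hp₀
  have hsup : kernelSup D p₀ k ≠ 0 :=
    ((enorm_pos.2 hne).trans_le ((le_max_left _ _).trans (le_kernelSup D k le_rfl hp))).ne'
  rw [B3_eq]
  refine mul_ne_zero hC0 (ne_of_gt ?_)
  exact (ENNReal.mul_pos (enorm_ne_zero.2 hk) hsup).trans_le
    (le_iSup (fun k => ‖k‖ₑ * kernelSup D p₀ k) k)

end KernelConstants

/-! ### Volterra inequalities under an exponential weight -/

section ExpWeight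

/-- The weight `e^{-ωp}` of the Laplace transform. -/
noncomputable def expWeight (ω p : ℝ) : ℝ≥0∞ := ENNReal.ofReal (Real.exp (-ω * p))

@[fun_prop]
theorem measurable_expWeight (ω : ℝ) : Measurable (expWeight ω) := by
  unfold expWeight
  fun_prop

theorem expWeight_le_one {ω p : ℝ} (hω : 0 ≤ ω) (hp : 0 ≤ p) : expWeight ω p ≤ 1 := by
  rw [expWeight, ENNReal.ofReal_le_one, Real.exp_le_one_iff, neg_mul, neg_nonpos]
  exact mul_nonneg hω hp

theorem expWeight_add (ω s t : ℝ) : expWeight ω (s + t) = expWeight ω s * expWeight ω t := by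
  rw [expWeight, expWeight, expWeight, ← ENNReal.ofReal_mul (Real.exp_pos _).le, ← Real.exp_add,
    mul_add]

theorem lintegral_expWeight_mul_lconvolution (ω : ℝ) {f g : ℝ → ℝ≥0∞} (hf : Measurable f)
    (hg : Measurable g) :
    ∫⁻ p, expWeight ω p * (f ⋆ₗ g) p =
      (∫⁻ p, expWeight ω p * f p) * ∫⁻ p, expWeight ω p * g p := by
  rw [← lintegral_lconvolution (by fun_prop) (by fun_prop)]
  refine lintegral_congr fun p => ?_
  rw [lconvolution_def, lconvolution_def, ← lintegral_const_mul _ (by fun_prop)]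
  refine lintegral_congr fun s => ?_
  rw [mul_mul_mul_comm, ← expWeight_add, add_neg_cancel_left]

theorem ofReal_mul_lintegral_expWeight_Ici {ω : ℝ} (hω : 0 < ω) :
    ENNReal.ofReal ω * ∫⁻ t in Ici 0, expWeight ω t = 1 := by
  have hneg : -ω < 0 := neg_lt_zero.2 hω
  simp only [setLIntegral_congr Ioi_ae_eq_Ici.symm, expWeight]
  rw [← ofReal_integral_eq_lintegral_ofReal (integrableOn_exp_mul_Ioi hneg 0)
      (ae_of_all _ fun t => (Real.exp_pos _).le),
    ← ENNReal.ofReal_mul hω.le, integral_exp_mul_Ioi hneg, mul_zero, Real.exp_zero, neg_div_neg_eq,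
    mul_one_div_cancel hω.ne', ENNReal.ofReal_one]

theorem lintegral_mul_indicator {α : Type*} [MeasurableSpace α] {m : Measure α} (w f : α → ℝ≥0∞)
    {s : Set α} (hs : MeasurableSet s) :
    ∫⁻ x, w x * s.indicator f x ∂m = ∫⁻ x in s, w x * f x ∂m := by
  rw [← lintegral_indicator hs]
  simp only [indicator_mul_right]

theorem setLIntegral_Ioc_le_lconvolution (F : ℝ → ℝ≥0∞) (a p : ℝ) :
    ∫⁻ s in Ioc a p, F s ≤ (F ⋆ₗ (Ici 0).indicator 1) p := by
  rw [← lintegral_indicator measurableSet_Ioc]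
  refine lintegral_mono fun s => indicator_apply_le' (fun hs => ?_) fun _ => zero_le
  have hmem : -s + p ∈ Ici (0 : ℝ) := by simpa using hs.2
  rw [indicator_of_mem hmem, Pi.one_apply, mul_one]

theorem ofReal_mul_lintegral_expWeight_mul_primitive_le {ω : ℝ} (hω : 0 < ω) {F : ℝ → ℝ≥0∞}
    (hF : Measurable F) (a : ℝ) :
    ENNReal.ofReal ω * ∫⁻ p, expWeight ω p * ∫⁻ s in Ioc a p, F s ≤
      ∫⁻ p, expWeight ω p * F p := by
  calc ENNReal.ofReal ω * ∫⁻ p, expWeight ω p * ∫⁻ s in Ioc a p, F s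
      ≤ ENNReal.ofReal ω * ∫⁻ p, expWeight ω p * (F ⋆ₗ (Ici 0).indicator 1) p := by
        gcongr with p
        exact setLIntegral_Ioc_le_lconvolution F a p
    _ = (ENNReal.ofReal ω * ∫⁻ t in Ici 0, expWeight ω t) * ∫⁻ p, expWeight ω p * F p := by
        rw [lintegral_expWeight_mul_lconvolution ω hF (measurable_one.indicator measurableSet_Ici),
          lintegral_mul_indicator _ _ measurableSet_Ici, mul_comm (∫⁻ p, _), mul_assoc]
        simp only [Pi.one_apply, mul_one]
    _ = ∫⁻ p, expWeight ω p * F p := by rw [ofReal_mul_lintegral_expWeight_Ici hω, one_mul]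

theorem measurable_setLIntegral_Ioc (F : ℝ → ℝ≥0∞) (a : ℝ) :
    Measurable fun p => ∫⁻ s in Ioc a p, F s :=
  Monotone.measurable fun _ _ hpq => lintegral_mono_set (Ioc_subset_Ioc_right hpq)

theorem ofReal_mul_setLIntegral_Ioc_le_of_primitive {ω : ℝ} (hω : 0 < ω) {h hs F : ℝ → ℝ≥0∞}
    (hF : Measurable F) {a L : ℝ}
    (hineq : ∀ᵐ p ∂volume.restrict (Ioc a L), h p ≤ hs p + ∫⁻ s in Ioc a p, F s) :
    ENNReal.ofReal ω * (∫⁻ p in Ioc a L, expWeight ω p * h p) ≤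
      ENNReal.ofReal ω * (∫⁻ p in Ioi a, expWeight ω p * hs p) + ∫⁻ p, expWeight ω p * F p := by
  have hprim := measurable_setLIntegral_Ioc F a
  have hsplit : ∫⁻ p in Ioc a L, expWeight ω p * h p ≤ (∫⁻ p in Ioi a, expWeight ω p * hs p)
      + ∫⁻ p, expWeight ω p * ∫⁻ s in Ioc a p, F s :=
    calc ∫⁻ p in Ioc a L, expWeight ω p * h p
        ≤ ∫⁻ p in Ioc a L, (expWeight ω p * hs p + expWeight ω p * ∫⁻ s in Ioc a p, F s) :=
          lintegral_mono_ae <| hineq.mono fun p hp =>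
            (mul_le_mul_right hp _).trans_eq (mul_add _ _ _)
      _ = (∫⁻ p in Ioc a L, expWeight ω p * hs p)
            + ∫⁻ p in Ioc a L, expWeight ω p * ∫⁻ s in Ioc a p, F s :=
          lintegral_add_right _ (by fun_prop)
      _ ≤ _ := add_le_add (lintegral_mono_set Ioc_subset_Ioi_self) (setLIntegral_le_lintegral _ _)
  calc ENNReal.ofReal ω * (∫⁻ p in Ioc a L, expWeight ω p * h p)
      ≤ ENNReal.ofReal ω * (∫⁻ p in Ioi a, expWeight ω p * hs p)
        + ENNReal.ofReal ω * ∫⁻ p, expWeight ω p * ∫⁻ s in Ioc a p, F s := by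
        rw [← mul_add]
        gcongr
    _ ≤ _ := add_le_add_right (ofReal_mul_lintegral_expWeight_mul_primitive_le hω hF a) _

end ExpWeight

section Volterra

variable {c β : ℝ≥0∞} {f f' g g' h hs : ℝ → ℝ≥0∞} {a L p p₀ ω : ℝ}

theorem lconvolution_le_of_le_on_Iic (hf₀ : ∀ s ≤ 0, f s = 0) (hg₀ : ∀ s ≤ 0, g s = 0)
    (hf : ∀ s ≤ L, f s ≤ f' s) (hg : ∀ s ≤ L, g s ≤ g' s) (hp : p ≤ L) :
    (f ⋆ₗ g) p ≤ (f' ⋆ₗ g') p := by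
  refine lintegral_mono fun s => ?_
  rcases le_or_gt s 0 with hs | hs
  · rw [hf₀ s hs, zero_mul]
    exact zero_le
  rcases le_or_gt p s with hps | hps
  · rw [hg₀ (-s + p) (by linarith), mul_zero]
    exact zero_le
  · exact mul_le_mul' (hf s (by linarith)) (hg _ (by linarith))

/-- The density of the quadratic Volterra operator `f ↦ ∫ (c f + β (g * f + f * g + f * f))`, with
`*` the Laplace convolution. Here `g` stands for the known part of a function and `f` for the
remaining part. -/
noncomputable def volterra (c β : ℝ≥0∞) (g f : ℝ → ℝ≥0∞) (p : ℝ) : ℝ≥0∞ :=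
  c * f p + β * ((g ⋆ₗ f) p + (f ⋆ₗ g) p + (f ⋆ₗ f) p)

theorem measurable_volterra (c β : ℝ≥0∞) (hg : Measurable g) (hf : Measurable f) :
    Measurable (volterra c β g f) :=
  (hf.const_mul c).add ((((measurable_lconvolution _ hg hf).add
    (measurable_lconvolution _ hf hg)).add (measurable_lconvolution _ hf hf)).const_mul β)

theorem volterra_le_of_le_on_Iic (hg₀ : ∀ s ≤ 0, g s = 0) (hf₀ : ∀ s ≤ 0, f s = 0)
    (hf : ∀ s ≤ L, f s ≤ f' s) (hp : p ≤ L) : volterra c β g f p ≤ volterra c β g f' p := by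
  unfold volterra
  gcongr c * ?_ + β * (?_ + ?_ + ?_)
  · exact hf p hp
  · exact lconvolution_le_of_le_on_Iic hg₀ hf₀ (fun _ _ => le_rfl) hf hp
  · exact lconvolution_le_of_le_on_Iic hf₀ hg₀ hf (fun _ _ => le_rfl) hp
  · exact lconvolution_le_of_le_on_Iic hf₀ hf₀ hf hf hp

theorem volterra_indicator_Ioi_le (hp₀ : 0 ≤ p₀) (hp : p ≤ L) :
    volterra c β ((Ioc 0 p₀).indicator h) ((Ioi p₀).indicator h) p
      ≤ volterra c β ((Ioc 0 p₀).indicator h) ((Ioc p₀ L).indicator h) p := by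
  refine volterra_le_of_le_on_Iic (fun t ht => indicator_of_notMem (fun h => h.1.not_ge ht) _)
    (fun t ht => indicator_of_notMem (fun h => (hp₀.trans_lt h).not_ge ht) _) (fun t ht => ?_) hp
  exact indicator_apply_le' (fun ht' => (indicator_of_mem (mem_Ioc.2 ⟨ht', ht⟩) h).ge)
    fun _ => zero_le

theorem lintegral_expWeight_mul_volterra (ω : ℝ) (c β : ℝ≥0∞) (hg : Measurable g)
    (hf : Measurable f) :
    ∫⁻ p, expWeight ω p * volterra c β g f p =
      (c + 2 * β * ∫⁻ p, expWeight ω p * g p) * (∫⁻ p, expWeight ω p * f p)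
        + β * (∫⁻ p, expWeight ω p * f p) ^ 2 := by
  have := measurable_lconvolution volume hg hf
  have := measurable_lconvolution volume hf hg
  have := measurable_lconvolution volume hf hf
  have hexpand (p : ℝ) : expWeight ω p * volterra c β g f p = c * (expWeight ω p * f p) +
      β * (expWeight ω p * (g ⋆ₗ f) p + expWeight ω p * (f ⋆ₗ g) p
        + expWeight ω p * (f ⋆ₗ f) p) := by
    rw [volterra]
    ring
  simp only [hexpand]
  rw [lintegral_add_left (by fun_prop), lintegral_const_mul _ (by fun_prop),
    lintegral_const_mul _ (by fun_prop), lintegral_add_left (by fun_prop),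
    lintegral_add_left (by fun_prop), lintegral_expWeight_mul_lconvolution ω hg hf,
    lintegral_expWeight_mul_lconvolution ω hf hg, lintegral_expWeight_mul_lconvolution ω hf hf]
  ring

/-- `X` starts at `0` and cannot take the midpoint `(ω - ε) / (2β)` of the two roots of the
quadratic as a value. -/
theorem lt_of_quadratic {X : ℝ → ℝ} (hX : ContinuousOn X (Ici p₀)) (h₀ : X p₀ = 0)
    {ω ε β c : ℝ} (hβ : 0 < β) (hc : 0 ≤ c) (hlt : ε + 2 * √(β * c) < ω)
    (hquad : ∀ L ≥ p₀, ω * X L ≤ c + (ε * X L + β * X L ^ 2)) (hL : p₀ ≤ L) :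
    X L < (ω - ε) / (2 * β) := by
  have hsqrt := Real.sqrt_nonneg (β * c)
  by_contra! hle
  have hmid : 0 ≤ (ω - ε) / (2 * β) := div_nonneg (by linarith) (by linarith)
  obtain ⟨y, hy, hXy⟩ := intermediate_value_Icc hL (hX.mono Icc_subset_Ici_self)
    (show (ω - ε) / (2 * β) ∈ Icc (X p₀) (X L) from ⟨h₀ ▸ hmid, hle⟩)
  have hdisc : (ω - ε) ^ 2 ≤ 4 * (β * c) := by
    have hωε : ω - ε = 2 * β * X y := by
      rw [hXy]
      field_simp
    have := mul_le_mul_of_nonneg_left (hquad y hy.1) hβ.le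
    rw [hωε]
    nlinarith
  nlinarith [Real.sq_sqrt (mul_nonneg hβ.le hc)]

theorem continuousOn_toReal_setLIntegral_Ioc (hm : Measurable h)
    (hfin : ∀ L, ∫⁻ p in Ioc p₀ L, h p < ∞) :
    ContinuousOn (fun L => (∫⁻ p in Ioc p₀ L, h p).toReal) (Ici p₀) := by
  have hintegral : (fun L => (∫⁻ p in Ioc p₀ L, h p).toReal) =
      fun L => ∫ p in Ioc p₀ L, (h p).toReal := by
    funext L
    rw [integral_toReal hm.aemeasurable (ae_lt_top hm (hfin L).ne)]
  rw [hintegral]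
  intro L hL
  have hint : IntegrableOn (fun p => (h p).toReal) (Icc p₀ (L + 1)) := by
    rw [integrableOn_Icc_iff_integrableOn_Ioc]
    exact integrable_toReal_of_lintegral_ne_top hm.aemeasurable (hfin _).ne
  exact (intervalIntegral.continuousOn_primitive hint L
    ⟨hL, by linarith⟩).mono_of_mem_nhdsWithin (inter_mem_nhdsWithin _ (Iic_mem_nhds (by linarith)))

theorem setLIntegral_Ioi_le_of_forall_Ioc {M : ℝ≥0∞} (hM : ∀ L, ∫⁻ p in Ioc a L, h p ≤ M) :
    ∫⁻ p in Ioi a, h p ≤ M := by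
  have hunion : ⋃ n : ℕ, Ioc a (n : ℝ) = Ioi a :=
    iUnion_Ioc_eq_Ioi_self_iff.2 fun x _ => exists_nat_ge x
  rw [← hunion, setLIntegral_iUnion_of_directed _ (Monotone.directed_le fun m n hmn =>
    Ioc_subset_Ioc_right (by exact_mod_cast hmn))]
  exact iSup_le fun n : ℕ => hM n

theorem setLIntegral_Ioi_lt_top_of_quadratic (hm : Measurable h)
    (hfin : ∀ L, ∫⁻ p in Ioc p₀ L, h p < ∞) {b ε : ℝ≥0∞} (hβ : β ≠ 0) (hβt : β ≠ ∞)
    (hω : 0 ≤ ω) (hlt : ε + 2 * (β * b) ^ (1 / 2 : ℝ) < ENNReal.ofReal ω)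
    (hquad : ∀ L, ENNReal.ofReal ω * (∫⁻ p in Ioc p₀ L, h p) ≤
      b + (ε * (∫⁻ p in Ioc p₀ L, h p) + β * (∫⁻ p in Ioc p₀ L, h p) ^ 2)) :
    ∫⁻ p in Ioi p₀, h p < ∞ := by
  have hsum : ε + 2 * (β * b) ^ (1 / 2 : ℝ) ≠ ∞ := (hlt.trans ENNReal.ofReal_lt_top).ne
  obtain ⟨hε, hroot⟩ := ENNReal.add_ne_top.1 hsum
  have hb : b ≠ ∞ := by
    rintro rfl
    exact hroot (by norm_num [ENNReal.mul_top hβ])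
  have hlt' : ε.toReal + 2 * √(β.toReal * b.toReal) < ω := by
    have := (ENNReal.toReal_lt_toReal hsum ENNReal.ofReal_ne_top).2 hlt
    rwa [ENNReal.toReal_add hε hroot, ENNReal.toReal_mul, ENNReal.toReal_ofNat,
      ← ENNReal.toReal_rpow, ENNReal.toReal_mul, ← Real.sqrt_eq_rpow,
      ENNReal.toReal_ofReal hω] at this
  have hbound (L : ℝ) : ∫⁻ p in Ioc p₀ L, h p ≤
      ENNReal.ofReal ((ω - ε.toReal) / (2 * β.toReal)) := by
    rcases lt_or_ge L p₀ with hL | hL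
    · simp [Ioc_eq_empty_of_le hL.le]
    rw [← ENNReal.ofReal_toReal (hfin L).ne]
    refine ENNReal.ofReal_le_ofReal (lt_of_quadratic (continuousOn_toReal_setLIntegral_Ioc hm hfin)
      (by simp) (ENNReal.toReal_pos hβ hβt) ENNReal.toReal_nonneg hlt' (fun M _ => ?_) hL).le
    have hXM := (hfin M).ne
    have hlin := ENNReal.mul_ne_top hε hXM
    have hsq := ENNReal.mul_ne_top hβt (ENNReal.pow_ne_top hXM (n := 2))
    have hrhs := ENNReal.add_ne_top.2 ⟨hb, ENNReal.add_ne_top.2 ⟨hlin, hsq⟩⟩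
    have := ENNReal.toReal_mono hrhs (hquad M)
    rwa [ENNReal.toReal_add hb (ENNReal.add_ne_top.2 ⟨hlin, hsq⟩), ENNReal.toReal_add hlin hsq,
      ENNReal.toReal_mul, ENNReal.toReal_mul, ENNReal.toReal_mul, ENNReal.toReal_pow,
      ENNReal.toReal_ofReal hω] at this
  exact (setLIntegral_Ioi_le_of_forall_Ioc hbound).trans_lt ENNReal.ofReal_lt_top

theorem mul_setLIntegral_Ioc_le_quadratic (hm : Measurable h) (hp₀ : 0 < p₀) (hω : 0 < ω)
    (hineq : ∀ᵐ p ∂volume.restrict (Ioi p₀), h p ≤ hs p +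
      ∫⁻ s in Ioc p₀ p, volterra c β ((Ioc 0 p₀).indicator h) ((Ioi p₀).indicator h) s) (L : ℝ) :
    ENNReal.ofReal ω * (∫⁻ p in Ioc p₀ L, expWeight ω p * h p) ≤
      ENNReal.ofReal ω * (∫⁻ p in Ioi p₀, expWeight ω p * hs p) +
        ((c + 2 * β * ∫⁻ p in Ioc 0 p₀, expWeight ω p * h p)
            * (∫⁻ p in Ioc p₀ L, expWeight ω p * h p)
          + β * (∫⁻ p in Ioc p₀ L, expWeight ω p * h p) ^ 2) := by
  have hgm : Measurable ((Ioc 0 p₀).indicator h) := hm.indicator measurableSet_Ioc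
  have hfm : Measurable ((Ioc p₀ L).indicator h) := hm.indicator measurableSet_Ioc
  have htrunc : ∀ᵐ p ∂volume.restrict (Ioc p₀ L), h p ≤ hs p + ∫⁻ s in Ioc p₀ p,
      volterra c β ((Ioc 0 p₀).indicator h) ((Ioc p₀ L).indicator h) s := by
    filter_upwards [ae_mono (Measure.restrict_mono_set _ Ioc_subset_Ioi_self) hineq,
      ae_restrict_mem measurableSet_Ioc] with p hp hpL
    refine hp.trans (add_le_add_right (setLIntegral_mono' measurableSet_Ioc fun s hs => ?_) _)
    exact volterra_indicator_Ioi_le hp₀.le (hs.2.trans hpL.2)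
  refine (ofReal_mul_setLIntegral_Ioc_le_of_primitive hω (measurable_volterra c β hgm hfm)
    htrunc).trans_eq ?_
  rw [lintegral_expWeight_mul_volterra ω c β hgm hfm, lintegral_mul_indicator _ _ measurableSet_Ioc,
    lintegral_mul_indicator _ _ measurableSet_Ioc]

theorem lintegral_expWeight_lt_top_of_volterra (hm : Measurable h)
    (hloc : ∀ L, ∫⁻ p in Ioc 0 L, h p < ∞) (hp₀ : 0 < p₀) (hβ : β ≠ 0) (hβt : β ≠ ∞) (hω : 0 < ω)
    (hineq : ∀ᵐ p ∂volume.restrict (Ioi p₀), h p ≤ hs p +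
      ∫⁻ s in Ioc p₀ p, volterra c β ((Ioc 0 p₀).indicator h) ((Ioi p₀).indicator h) s)
    (hlt : (c + 2 * β * ∫⁻ p in Ioc 0 p₀, expWeight ω p * h p)
      + 2 * (β * (ENNReal.ofReal ω * ∫⁻ p in Ioi p₀, expWeight ω p * hs p)) ^ (1 / 2 : ℝ)
        < ENNReal.ofReal ω) :
    ∫⁻ p in Ioi 0, expWeight ω p * h p < ∞ := by
  have hfin (L : ℝ) : ∫⁻ p in Ioc 0 L, expWeight ω p * h p < ∞ := by
    refine (setLIntegral_mono' measurableSet_Ioc fun p hp => ?_).trans_lt (hloc L)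
    exact mul_le_of_le_one_left zero_le (expWeight_le_one hω.le hp.1.le)
  have htail : ∫⁻ p in Ioi p₀, expWeight ω p * h p < ∞ :=
    setLIntegral_Ioi_lt_top_of_quadratic (by fun_prop)
      (fun L => (lintegral_mono_set (Ioc_subset_Ioc_left hp₀.le)).trans_lt (hfin L)) hβ hβt hω.le
      hlt (mul_setLIntegral_Ioc_le_quadratic hm hp₀ hω hineq)
  rw [← Ioc_union_Ioi_eq_Ioi hp₀.le]
  exact (lintegral_union_le _ _ _).trans_lt (ENNReal.add_lt_top.2 ⟨hfin p₀, htail⟩)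

end Volterra

/-! ### Pairs and the Hodge projection -/

section Pairs

variable {E F : Type*} [NormedAddCommGroup E] [NormedAddCommGroup F]

/-- The Euclidean modulus of a pair as an extended nonnegative number, so that it can be
integrated without measurability or integrability conditions. -/
noncomputable def enormPair (v : E) (s : F) : ℝ≥0∞ := ‖WithLp.toLp 2 (v, s)‖ₑ

theorem enormPair_eq_ofReal (v : E) (s : F) :
    enormPair v s = ENNReal.ofReal √(‖v‖ ^ 2 + ‖s‖ ^ 2) := by
  rw [enormPair, ← ofReal_norm, WithLp.prod_norm_eq_of_L2]
  rfl

theorem enorm_pairAbs {d : ℕ} (v : CVec d) (s : ℂ) : ‖pairAbs v s‖ₑ = enormPair v s := by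
  rw [enormPair_eq_ofReal, pairAbs, Real.enorm_of_nonneg (Real.sqrt_nonneg _)]

theorem enormPair_mono {v v' : E} {s s' : F} (hv : ‖v‖ ≤ ‖v'‖) (hs : ‖s‖ ≤ ‖s'‖) :
    enormPair v s ≤ enormPair v' s' := by
  simp only [enormPair_eq_ofReal]
  gcongr

theorem enormPair_add_le (v v' : E) (s s' : F) :
    enormPair (v + v') (s + s') ≤ enormPair v s + enormPair v' s' :=
  enorm_add_le (WithLp.toLp 2 (v, s)) (WithLp.toLp 2 (v', s'))

@[simp]
theorem enormPair_zero_right (v : E) : enormPair v (0 : F) = ‖v‖ₑ := by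
  rw [enormPair_eq_ofReal, norm_zero, zero_pow two_ne_zero, add_zero,
    Real.sqrt_sq (norm_nonneg v), ofReal_norm]

theorem enorm_fst_le_enormPair (v : E) (s : F) : ‖v‖ₑ ≤ enormPair v s := by
  rw [← enormPair_zero_right (F := F)]
  exact enormPair_mono le_rfl (by simp)

theorem enorm_snd_le_enormPair (v : E) (s : F) : ‖s‖ₑ ≤ enormPair v s := by
  rw [enormPair_eq_ofReal, ← ofReal_norm]
  exact ENNReal.ofReal_le_ofReal (Real.le_sqrt_of_sq_le (le_add_of_nonneg_left (sq_nonneg _)))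

theorem measurable_enormPair [MeasurableSpace E] [BorelSpace E] [MeasurableSpace F] [BorelSpace F]
    {α : Type*} [MeasurableSpace α] {f : α → E} {g : α → F} (hf : Measurable f)
    (hg : Measurable g) : Measurable fun x => enormPair (f x) (g x) := by
  simp only [enormPair_eq_ofReal]
  fun_prop

variable [NormedSpace ℂ E] [NormedSpace ℂ F]

theorem enormPair_smul (c : ℂ) (v : E) (s : F) :
    enormPair (c • v) (c • s) = ‖c‖ₑ * enormPair v s :=
  enorm_smul c (WithLp.toLp 2 (v, s))

theorem enormPair_smul_le (c c' : ℂ) (v : E) (s : F) :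
    enormPair (c • v) (c' • s) ≤ max ‖c‖ₑ ‖c'‖ₑ * enormPair v s := by
  rcases le_total ‖c‖ ‖c'‖ with h | h
  · calc enormPair (c • v) (c' • s) ≤ enormPair (c' • v) (c' • s) :=
          enormPair_mono (by rw [norm_smul, norm_smul]; gcongr) le_rfl
      _ ≤ max ‖c‖ₑ ‖c'‖ₑ * enormPair v s := by
          rw [enormPair_smul]
          gcongr
          exact le_max_right _ _
  · calc enormPair (c • v) (c' • s) ≤ enormPair (c • v) (c • s) :=
          enormPair_mono le_rfl (by rw [norm_smul, norm_smul]; gcongr)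
      _ ≤ max ‖c‖ₑ ‖c'‖ₑ * enormPair v s := by
          rw [enormPair_smul]
          gcongr
          exact le_max_left _ _

theorem enormPair_integral_le [CompleteSpace E] [CompleteSpace F] {α : Type*} [MeasurableSpace α]
    {m : Measure α} {f : α → E} {g : α → F} (hf : Integrable f m) (hg : Integrable g m) :
    enormPair (∫ x, f x ∂m) (∫ x, g x ∂m) ≤ ∫⁻ x, enormPair (f x) (g x) ∂m := by
  have hpair : WithLp.toLp 2 (∫ x, f x ∂m, ∫ x, g x ∂m) = ∫ x, WithLp.toLp 2 (f x, g x) ∂m := by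
    rw [← integral_pair hf hg]
    exact ((WithLp.prodContinuousLinearEquiv 2 ℂ E F).symm.integral_comp_comm _).symm
  rw [enormPair, hpair]
  exact enorm_integral_le_lintegral_enorm _

theorem sum_smul_integral {ι α : Type*} [Fintype ι] [MeasurableSpace α] {m : Measure α}
    (c : ι → ℂ) {f : ι → α → E} (hf : ∀ j, Integrable (f j) m) :
    ∑ j, c j • ∫ x, f j x ∂m = ∫ x, ∑ j, c j • f j x ∂m := by
  rw [integral_finsetSum (f := fun j x => c j • f j x) _ fun j _ => (hf j).smul (c j)]
  simp only [integral_smul]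

theorem integrable_sum_smul {ι α : Type*} [Fintype ι] [MeasurableSpace α] {m : Measure α}
    (c : ι → ℂ) {f : ι → α → E} (hf : ∀ j, Integrable (f j) m) :
    Integrable (fun x => ∑ j, c j • f j x) m :=
  integrable_finsetSum _ fun j _ => (hf j).smul (c j)

theorem enormPair_sum_integral_le [CompleteSpace E] [CompleteSpace F] {ι α : Type*} [Fintype ι]
    [MeasurableSpace α] {m : Measure α} (c : ι → ℂ) {f : ι → α → E} {g : ι → α → F}
    (hf : ∀ j, Integrable (f j) m) (hg : ∀ j, Integrable (g j) m) :
    enormPair (∑ j, c j • ∫ x, f j x ∂m) (∑ j, c j • ∫ x, g j x ∂m)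
      ≤ ∫⁻ x, enormPair (∑ j, c j • f j x) (∑ j, c j • g j x) ∂m := by
  rw [sum_smul_integral c hf, sum_smul_integral c hg]
  exact enormPair_integral_le (integrable_sum_smul c hf) (integrable_sum_smul c hg)

end Pairs

section Hodge

variable {d : ℕ}

theorem enorm_apply_le (v : CVec d) (j : Fin d) : ‖v j‖ₑ ≤ ‖v‖ₑ :=
  enorm_le_iff_norm_le.2 (PiLp.norm_apply_le v j)

/-- The wave vector `k ∈ ℝ^d` as a complex vector. -/
noncomputable def waveC (k : Wave d) : CVec d := WithLp.toLp 2 fun i => (k i : ℂ)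

theorem norm_waveC (k : Wave d) : ‖waveC k‖ = ‖k‖ := by
  simp [EuclideanSpace.norm_eq, waveC]

theorem inner_waveC (k : Wave d) (v : CVec d) : inner ℂ (waveC k) v = ∑ j, (k j : ℂ) * v j := by
  simp [PiLp.inner_apply, waveC, mul_comm]

theorem enorm_sum_mul_le (k : Wave d) (v : CVec d) : ‖∑ j, (k j : ℂ) * v j‖ₑ ≤ ‖k‖ₑ * ‖v‖ₑ := by
  rw [← inner_waveC, ← enorm_norm k, ← enorm_norm v, ← enorm_mul, ← norm_waveC]
  exact enorm_le_iff_norm_le.2 ((norm_inner_le_norm _ _).trans (le_abs_self _))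

/-- The Hodge projection as a continuous linear map. -/
noncomputable def hodgeL (k : Wave d) : CVec d →L[ℂ] CVec d :=
  ContinuousLinearMap.id ℂ (CVec d) -
    (((‖k‖ ^ 2 : ℝ) : ℂ)⁻¹ • innerSL ℂ (waveC k)).smulRight (waveC k)

theorem hodgeL_apply (k : Wave d) (v : CVec d) : hodgeL k v = hodge k v := by
  ext i
  simp only [hodgeL, hodge, ← inner_waveC, waveC, sub_apply,
    ContinuousLinearMap.id_apply, ContinuousLinearMap.smulRight_apply,
    smul_apply, innerSL_apply_apply, PiLp.sub_apply, PiLp.smul_apply,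
    smul_eq_mul]
  ring

theorem inner_waveC_hodgeL (k : Wave d) (v : CVec d) : inner ℂ (waveC k) (hodgeL k v) = 0 := by
  by_cases hk : k = 0
  · have hzero : waveC k = 0 := by rw [← norm_eq_zero, norm_waveC, hk, norm_zero]
    rw [hzero, inner_zero_left]
  have hk' : (‖k‖ : ℂ) ≠ 0 := by simpa using hk
  have hself : inner ℂ (waveC k) (waveC k) = (‖k‖ : ℂ) ^ 2 := by
    rw [inner_self_eq_norm_sq_to_K, norm_waveC]
    rfl
  simp only [hodgeL, sub_apply, ContinuousLinearMap.id_apply,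
    ContinuousLinearMap.smulRight_apply, smul_apply, innerSL_apply_apply,
    smul_eq_mul, inner_sub_right, inner_smul_right, hself]
  push_cast
  field_simp
  ring

theorem norm_hodge_le (k : Wave d) (v : CVec d) : ‖hodge k v‖ ≤ ‖v‖ := by
  rw [← hodgeL_apply]
  have hsub : v - hodgeL k v = (((‖k‖ ^ 2 : ℝ) : ℂ)⁻¹ * inner ℂ (waveC k) v) • waveC k :=
    sub_sub_cancel _ _
  have horth : inner ℂ (hodgeL k v) (v - hodgeL k v) = 0 := by
    rw [hsub, inner_smul_right, inner_eq_zero_symm.1 (inner_waveC_hodgeL k v), mul_zero]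
  have hpyth := norm_add_sq_eq_norm_sq_add_norm_sq_of_inner_eq_zero _ _ horth
  rw [add_sub_cancel] at hpyth
  refine (mul_self_le_mul_self_iff (norm_nonneg _) (norm_nonneg _)).2 ?_
  exact hpyth ▸ le_add_of_nonneg_right (mul_self_nonneg _)

theorem scaleVec_eq_smul (e : Wave d) (s : ℂ) : scaleVec e s = s • waveC e := by
  ext i
  simp [scaleVec, waveC, mul_comm]

theorem hodge_scaleVec (k e : Wave d) (s : ℂ) :
    hodge k (scaleVec e s) = s • hodge k (waveC e) := by
  rw [scaleVec_eq_smul, ← hodgeL_apply, ← hodgeL_apply, map_smul]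

theorem enorm_hodge_scaleVec_le (k e : Wave d) (s : ℂ) :
    ‖hodge k (scaleVec e s)‖ₑ ≤ ‖e‖ₑ * ‖s‖ₑ := by
  rw [hodge_scaleVec, enorm_smul, mul_comm]
  gcongr
  rw [← enorm_norm e, ← norm_waveC, enorm_norm]
  exact enorm_le_iff_norm_le.2 (norm_hodge_le k _)

end Hodge

/-! ### Majorants and Fourier convolutions -/

section FourierConv

variable {d : ℕ} {N : FourierNorm} {V : Type*} [NormedAddCommGroup V] [NormedSpace ℂ V]

theorem enorm_fourierConv_le (f : Wave d → ℂ) (g : Wave d → V) (k : Wave d) :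
    ‖fourierConv f g k‖ₑ ≤ ((‖f ·‖ₑ) ⋆ₗ (‖g ·‖ₑ)) k := by
  refine (enorm_integral_le_lintegral_enorm _).trans_eq ?_
  simp only [lconvolution_def, enorm_smul, neg_add_eq_sub]

theorem enorm_fourierConv_le_enrm_mul_enrm [MeasurableSpace V] [BorelSpace V]
    (hN : N.Admissible d) {f : Wave d → ℂ} {g : Wave d → V} (hf : Measurable f)
    (hg : Measurable g) (k : Wave d) :
    ‖fourierConv f g k‖ₑ ≤ N.C0 d * (N.enrm (‖f ·‖ₑ) * N.enrm (‖g ·‖ₑ)) :=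
  calc ‖fourierConv f g k‖ₑ ≤ ((‖f ·‖ₑ) ⋆ₗ (‖g ·‖ₑ)) k := enorm_fourierConv_le f g k
    _ ≤ N.enrm ((‖f ·‖ₑ) ⋆ₗ (‖g ·‖ₑ)) := FourierNorm.le_enrm hN _ k
    _ ≤ _ := FourierNorm.enrm_lconvolution_le hN hf.enorm hg.enorm

theorem measurable_lconvolution_apply {α : Type*} [MeasurableSpace α]
    {f g : Wave d → ℝ → ℝ≥0∞} (hf : Measurable (Function.uncurry f))
    (hg : Measurable (Function.uncurry g)) {κ : α → Wave d} {φ ψ : α → ℝ} (hκ : Measurable κ)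
    (hφ : Measurable φ) (hψ : Measurable ψ) :
    Measurable fun x => ((f · (φ x)) ⋆ₗ (g · (ψ x))) (κ x) := by
  refine Measurable.lintegral_prod_right' (f := fun y : α × Wave d =>
    Function.uncurry f (y.2, φ y.1) * Function.uncurry g (-y.2 + κ y.1, ψ y.1)) ?_
  fun_prop

theorem measurable_setLIntegral_Ioc_zero {α : Type*} [MeasurableSpace α] {f : α × ℝ → ℝ≥0∞}
    (hf : Measurable f) {φ : α → ℝ} (hφ : Measurable φ) :
    Measurable fun x => ∫⁻ s in Ioc 0 (φ x), f (x, s) := by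
  simp only [← lintegral_indicator (measurableSet_Ioc (α := ℝ))]
  refine Measurable.lintegral_prod_right'
    (f := {y : α × ℝ | 0 < y.2 ∧ y.2 ≤ φ y.1}.indicator f) (hf.indicator ?_)
  exact (measurableSet_lt measurable_const measurable_snd).inter
    (measurableSet_le measurable_snd (by fun_prop))

theorem stronglyMeasurable_setIntegral_Ioc_zero {f : ℝ × ℝ → V} (hf : StronglyMeasurable f) :
    StronglyMeasurable fun p : ℝ => ∫ s in Ioc 0 p, f (p, s) := by
  simp only [← integral_indicator (measurableSet_Ioc (α := ℝ))]
  refine StronglyMeasurable.integral_prod_right'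
    (f := {y : ℝ × ℝ | 0 < y.2 ∧ y.2 ≤ y.1}.indicator f) (hf.indicator ?_)
  exact (measurableSet_lt measurable_const measurable_snd).inter
    (measurableSet_le measurable_snd measurable_fst)

variable [MeasurableSpace V] [BorelSpace V] [SecondCountableTopology V]

variable {α : Type*} [MeasurableSpace α] {F : Wave d → α → ℂ} {G : Wave d → α → V}

theorem stronglyMeasurable_fourierConv (hF : Measurable (Function.uncurry F))
    (hG : Measurable (Function.uncurry G)) (k : Wave d) :
    StronglyMeasurable fun x => fourierConv (F · x) (G · x) k := by
  refine StronglyMeasurable.integral_prod_right' (f := fun y : α × Wave d =>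
    Function.uncurry F (y.2, y.1) • Function.uncurry G (k - y.2, y.1)) ?_
  exact Measurable.stronglyMeasurable (by fun_prop)

theorem integrable_fourierConv {m : Measure α} (hN : N.Admissible d)
    (hF : Measurable (Function.uncurry F)) (hG : Measurable (Function.uncurry G))
    (hfin : ∫⁻ x, N.enrm (‖F · x‖ₑ) * N.enrm (‖G · x‖ₑ) ∂m < ∞) (k : Wave d) :
    Integrable (fun x => fourierConv (F · x) (G · x) k) m := by
  refine ⟨(stronglyMeasurable_fourierConv hF hG k).aestronglyMeasurable, ?_⟩
  calc ∫⁻ x, ‖fourierConv (F · x) (G · x) k‖ₑ ∂m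
      ≤ ∫⁻ x, N.C0 d * (N.enrm (‖F · x‖ₑ) * N.enrm (‖G · x‖ₑ)) ∂m :=
        lintegral_mono fun x => enorm_fourierConv_le_enrm_mul_enrm hN hF.of_uncurry_right
          hG.of_uncurry_right k
    _ < ∞ := by
        rw [lintegral_const_mul' _ _ (FourierNorm.C0_lt_top hN).ne]
        exact ENNReal.mul_lt_top (FourierNorm.C0_lt_top hN) hfin

end FourierConv

/-- `h` is a measurable majorant on `(0, ∞)` of the norm in `k` of the measurable function
`F(k, p)`, integrable on bounded intervals and extended by zero to `p ≤ 0`. The norm itself need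
not be measurable in `p`, so that it cannot be used in place of `h`. -/
structure IsMajorant {d : ℕ} {E : Type*} [MeasurableSpace E] [ENorm E] (N : FourierNorm)
    (F : Wave d → ℝ → E) (h : ℝ → ℝ≥0∞) : Prop where
  measurable_fun : Measurable (Function.uncurry F)
  measurable_majorant : Measurable h
  zero_of_nonpos : ∀ p ≤ 0, h p = 0
  lintegral_lt_top : ∀ L, ∫⁻ p in Ioc 0 L, h p < ∞
  enrm_le : ∀ᵐ p, 0 < p → N.enrm (‖F · p‖ₑ) ≤ h p

namespace IsMajorant

section ENorm

variable {d : ℕ} {N : FourierNorm} {E E' : Type*} [MeasurableSpace E] [ENorm E]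
  [MeasurableSpace E'] [ENorm E'] {F : Wave d → ℝ → E} {G : Wave d → ℝ → E'} {h h' : ℝ → ℝ≥0∞}

theorem of_enorm_le (hF : IsMajorant N F h) (hG : Measurable (Function.uncurry G))
    (hle : ∀ k p, ‖G k p‖ₑ ≤ ‖F k p‖ₑ) : IsMajorant N G h where
  measurable_fun := hG
  measurable_majorant := hF.measurable_majorant
  zero_of_nonpos := hF.zero_of_nonpos
  lintegral_lt_top := hF.lintegral_lt_top
  enrm_le := by
    filter_upwards [hF.enrm_le] with p hp hp0
    exact (FourierNorm.enrm_mono fun k => hle k p).trans (hp hp0)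

theorem ae_enrm_mul_enrm_le (hF : IsMajorant N F h) (hG : IsMajorant N G h') (p : ℝ) :
    ∀ᵐ s, s ∈ Ioc 0 p → N.enrm (‖F · s‖ₑ) * N.enrm (‖G · (p - s)‖ₑ) ≤ h s * h' (-s + p) := by
  have hsub := (Measure.measurePreserving_sub_left volume p).quasiMeasurePreserving
  filter_upwards [hF.enrm_le, hsub.ae hG.enrm_le, Measure.ae_ne volume p] with s hs hps hne hmem
  rw [neg_add_eq_sub]
  exact mul_le_mul' (hs hmem.1) (hps (sub_pos.2 (hmem.2.lt_of_ne hne)))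

theorem setLIntegral_enrm_mul_enrm_le (hF : IsMajorant N F h) (hG : IsMajorant N G h') (p : ℝ) :
    ∫⁻ s in Ioc 0 p, N.enrm (‖F · s‖ₑ) * N.enrm (‖G · (p - s)‖ₑ) ≤ (h ⋆ₗ h') p :=
  (setLIntegral_mono_ae' measurableSet_Ioc (hF.ae_enrm_mul_enrm_le hG p)).trans
    (setLIntegral_le_lintegral _ _)

theorem setLIntegral_lconvolution_lt_top (hF : IsMajorant N F h) (hG : IsMajorant N G h')
    (L : ℝ) : ∫⁻ p in Ioc 0 L, (h ⋆ₗ h') p < ∞ := by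
  have hle {g : ℝ → ℝ≥0∞} (hg₀ : ∀ s ≤ 0, g s = 0) : ∀ s ≤ L, g s ≤ (Ioc 0 L).indicator g s :=
    fun s hs => by
      rcases le_or_gt s 0 with hs₀ | hs₀
      · simp [hg₀ s hs₀]
      · rw [indicator_of_mem (mem_Ioc.2 ⟨hs₀, hs⟩)]
  calc ∫⁻ p in Ioc 0 L, (h ⋆ₗ h') p
      ≤ ∫⁻ p in Ioc 0 L, ((Ioc 0 L).indicator h ⋆ₗ (Ioc 0 L).indicator h') p :=
        setLIntegral_mono' measurableSet_Ioc fun p hp => lconvolution_le_of_le_on_Iic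
          hF.zero_of_nonpos hG.zero_of_nonpos (hle hF.zero_of_nonpos) (hle hG.zero_of_nonpos) hp.2
    _ ≤ ∫⁻ p, ((Ioc 0 L).indicator h ⋆ₗ (Ioc 0 L).indicator h') p :=
        setLIntegral_le_lintegral _ _
    _ = (∫⁻ p in Ioc 0 L, h p) * ∫⁻ p in Ioc 0 L, h' p := by
        rw [lintegral_lconvolution (hF.measurable_majorant.indicator measurableSet_Ioc)
          (hG.measurable_majorant.indicator measurableSet_Ioc),
          lintegral_indicator measurableSet_Ioc, lintegral_indicator measurableSet_Ioc]
    _ < ∞ := ENNReal.mul_lt_top (hF.lintegral_lt_top L) (hG.lintegral_lt_top L)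

theorem ae_lconvolution_lt_top (hF : IsMajorant N F h) (hG : IsMajorant N G h') :
    ∀ᵐ p, 0 < p → (h ⋆ₗ h') p < ∞ := by
  have hbdd (n : ℕ) : ∀ᵐ p, p ∈ Ioc 0 (n : ℝ) → (h ⋆ₗ h') p < ∞ := by
    rw [← ae_restrict_iff' measurableSet_Ioc]
    exact ae_lt_top (measurable_lconvolution volume hF.measurable_majorant hG.measurable_majorant)
      (hF.setLIntegral_lconvolution_lt_top hG n).ne
  filter_upwards [ae_all_iff.2 hbdd] with p hp hp0
  obtain ⟨n, hn⟩ := exists_nat_ge p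
  exact hp n ⟨hp0, hn⟩

end ENorm

variable {d : ℕ} {N : FourierNorm} {V : Type*} [NormedAddCommGroup V] [MeasurableSpace V]
  [BorelSpace V] {F : Wave d → ℝ → ℂ} {G : Wave d → ℝ → V}
  {h h' : ℝ → ℝ≥0∞} {f : Wave d → ℂ} {g : Wave d → V}

theorem enorm_fourierLaplaceConv_le [NormedSpace ℂ V] (hF : IsMajorant N F h)
    (hG : IsMajorant N G h') (hN : N.Admissible d) (k : Wave d) {p : ℝ} (hp : 0 ≤ p) :
    ‖fourierLaplaceConv F G k p‖ₑ ≤ N.C0 d * (h ⋆ₗ h') p := by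
  rw [fourierLaplaceConv, intervalIntegral.integral_of_le hp]
  calc ‖∫ s in Ioc 0 p, fourierConv (F · s) (G · (p - s)) k‖ₑ
      ≤ ∫⁻ s in Ioc 0 p, N.C0 d * (N.enrm (‖F · s‖ₑ) * N.enrm (‖G · (p - s)‖ₑ)) :=
        (enorm_integral_le_lintegral_enorm _).trans <| lintegral_mono fun s =>
          enorm_fourierConv_le_enrm_mul_enrm hN hF.measurable_fun.of_uncurry_right
            hG.measurable_fun.of_uncurry_right k
    _ ≤ N.C0 d * (h ⋆ₗ h') p := by
        rw [lintegral_const_mul' _ _ (FourierNorm.C0_lt_top hN).ne]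
        gcongr
        exact hF.setLIntegral_enrm_mul_enrm_le hG p

variable [SecondCountableTopology V]

theorem integrableOn (hG : IsMajorant N G h) (hN : N.Admissible d) (k : Wave d) (L : ℝ) :
    IntegrableOn (G k) (Ioc 0 L) := by
  have hGk : Measurable (G k) := hG.measurable_fun.of_uncurry_left
  refine ⟨hGk.aestronglyMeasurable, lt_of_le_of_lt ?_ (hG.lintegral_lt_top L)⟩
  refine setLIntegral_mono_ae' measurableSet_Ioc ?_
  filter_upwards [hG.enrm_le] with p hp hpI
  exact (FourierNorm.le_enrm hN (‖G · p‖ₑ) k).trans (hp hpI.1)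

variable [NormedSpace ℂ V]

theorem integrableOn_fourierConv_left (hG : IsMajorant N G h) (hN : N.Admissible d)
    (hf : Measurable f) (hft : N.enrm (‖f ·‖ₑ) < ∞) (k : Wave d) (L : ℝ) :
    IntegrableOn (fun p => fourierConv f (G · p) k) (Ioc 0 L) := by
  refine integrable_fourierConv (F := fun q _ => f q) hN (by fun_prop) hG.measurable_fun ?_ k
  rw [lintegral_const_mul' _ _ hft.ne]
  refine ENNReal.mul_lt_top hft (lt_of_le_of_lt ?_ (hG.lintegral_lt_top L))
  exact setLIntegral_mono_ae' measurableSet_Ioc (hG.enrm_le.mono fun p hp hpI => hp hpI.1)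

theorem integrableOn_fourierConv_right (hF : IsMajorant N F h) (hN : N.Admissible d)
    (hg : Measurable g) (hgt : N.enrm (‖g ·‖ₑ) < ∞) (k : Wave d) (L : ℝ) :
    IntegrableOn (fun p => fourierConv (F · p) g k) (Ioc 0 L) := by
  refine integrable_fourierConv (G := fun q _ => g q) hN hF.measurable_fun (by fun_prop) ?_ k
  rw [lintegral_mul_const' _ _ hgt.ne]
  refine ENNReal.mul_lt_top (lt_of_le_of_lt ?_ (hF.lintegral_lt_top L)) hgt
  exact setLIntegral_mono_ae' measurableSet_Ioc (hF.enrm_le.mono fun p hp hpI => hp hpI.1)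

theorem integrableOn_fourierConv_sub (hF : IsMajorant N F h) (hG : IsMajorant N G h')
    (hN : N.Admissible d) {p : ℝ} (hfin : (h ⋆ₗ h') p < ∞) (k : Wave d) :
    IntegrableOn (fun s => fourierConv (F · s) (G · (p - s)) k) (Ioc 0 p) := by
  have := hG.measurable_fun
  exact integrable_fourierConv (G := fun q s => G q (p - s)) hN hF.measurable_fun
    (by unfold Function.uncurry at *; fun_prop)
    ((hF.setLIntegral_enrm_mul_enrm_le hG p).trans_lt hfin) k

theorem integrableOn_fourierLaplaceConv (hF : IsMajorant N F h) (hG : IsMajorant N G h')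
    (hN : N.Admissible d) (k : Wave d) (L : ℝ) :
    IntegrableOn (fourierLaplaceConv F G k) (Ioc 0 L) := by
  have := hF.measurable_fun
  have := hG.measurable_fun
  have hmeas : StronglyMeasurable fun x : ℝ × ℝ =>
      fourierConv (F · x.2) (G · (x.1 - x.2)) k :=
    stronglyMeasurable_fourierConv (F := fun q (x : ℝ × ℝ) => F q x.2)
      (G := fun q (x : ℝ × ℝ) => G q (x.1 - x.2)) (by unfold Function.uncurry at *; fun_prop)
      (by unfold Function.uncurry at *; fun_prop) k
  constructor
  · refine (stronglyMeasurable_setIntegral_Ioc_zero hmeas).aestronglyMeasurable.congr ?_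
    filter_upwards [ae_restrict_mem measurableSet_Ioc] with p hp
    rw [fourierLaplaceConv, intervalIntegral.integral_of_le hp.1.le]
  · refine (setLIntegral_mono' measurableSet_Ioc fun p hp =>
      hF.enorm_fourierLaplaceConv_le hG hN k hp.1.le).trans_lt ?_
    rw [lintegral_const_mul' _ _ (FourierNorm.C0_lt_top hN).ne]
    exact ENNReal.mul_lt_top (FourierNorm.C0_lt_top hN)
      (hF.setLIntegral_lconvolution_lt_top hG L)

end IsMajorant

/-! ### The known and the unknown part of the nonlinearity -/

/-- The restriction of `F(k, p)` to times `p ∈ A`, extended by zero. With `A = (0, p₀]` it is the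
known part `known p₀ F`; with `A = (p₀, ∞)` it is the part to be estimated. -/
noncomputable def restrictTime {d : ℕ} {V : Type*} [Zero V] (A : Set ℝ) (F : Wave d → ℝ → V) :
    Wave d → ℝ → V :=
  fun k => A.indicator (F k)

section RestrictTime

variable {d : ℕ} {V : Type*} {A B : Set ℝ}

theorem known_eq_restrictTime [Zero V] (p₀ : ℝ) (F : Wave d → ℝ → V) :
    known p₀ F = restrictTime (Ioc 0 p₀) F := rfl

theorem restrictTime_of_mem [Zero V] {p : ℝ} (h : p ∈ A) (F : Wave d → ℝ → V) (k : Wave d) :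
    restrictTime A F k p = F k p := indicator_of_mem h _

theorem restrictTime_of_notMem [Zero V] {p : ℝ} (h : p ∉ A) (F : Wave d → ℝ → V) (k : Wave d) :
    restrictTime A F k p = 0 := indicator_of_notMem h _

theorem restrictTime_coord (A : Set ℝ) (H : Wave d → ℝ → CVec d) (k : Wave d) (p : ℝ)
    (j : Fin d) : restrictTime A H k p j = restrictTime A (fun q s => H q s j) k p := by
  by_cases h : p ∈ A <;> simp [restrictTime, h]

theorem enormPair_restrictTime (A : Set ℝ) (H : Wave d → ℝ → CVec d) (S : Wave d → ℝ → ℂ)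
    (k : Wave d) (p : ℝ) : enormPair (restrictTime A H k p) (restrictTime A S k p)
      = restrictTime A (fun k p => enormPair (H k p) (S k p)) k p := by
  by_cases h : p ∈ A <;> simp [restrictTime, h]

theorem measurable_restrictTime [Zero V] [MeasurableSpace V] (hA : MeasurableSet A)
    {F : Wave d → ℝ → V} (hF : Measurable (Function.uncurry F)) :
    Measurable (Function.uncurry (restrictTime A F)) :=
  hF.indicator (s := Prod.snd ⁻¹' A) (measurable_snd hA)

theorem IsMajorant.restrict {N : FourierNorm} {E : Type*} [MeasurableSpace E]
    [TopologicalSpace E] [ESeminormedAddMonoid E] {F : Wave d → ℝ → E} {h : ℝ → ℝ≥0∞}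
    (hF : IsMajorant N F h) (hA : MeasurableSet A) :
    IsMajorant N (restrictTime A F) (A.indicator h) where
  measurable_fun := measurable_restrictTime hA hF.measurable_fun
  measurable_majorant := hF.measurable_majorant.indicator hA
  zero_of_nonpos p hp := indicator_apply_eq_zero.2 fun _ => hF.zero_of_nonpos p hp
  lintegral_lt_top L := (lintegral_mono (indicator_le_self A h)).trans_lt (hF.lintegral_lt_top L)
  enrm_le := by
    filter_upwards [hF.enrm_le] with p hp hp0
    by_cases hpA : p ∈ A
    · simpa only [restrictTime_of_mem hpA, indicator_of_mem hpA] using hp hp0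
    · simp only [restrictTime_of_notMem hpA, indicator_of_notMem hpA, enorm_zero,
        FourierNorm.enrm_zero, le_refl]

theorem IsMajorant.knownPart {N : FourierNorm} {E : Type*} [MeasurableSpace E]
    [TopologicalSpace E] [ESeminormedAddMonoid E] {F : Wave d → ℝ → E} {h : ℝ → ℝ≥0∞}
    (hF : IsMajorant N F h) (p₀ : ℝ) : IsMajorant N (known p₀ F) ((Ioc 0 p₀).indicator h) :=
  hF.restrict measurableSet_Ioc

theorem IsMajorant.coord {N : FourierNorm} {H : Wave d → ℝ → CVec d} {h : ℝ → ℝ≥0∞}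
    (hH : IsMajorant N H h) (j : Fin d) : IsMajorant N (fun q s => H q s j) h :=
  hH.of_enorm_le ((PiLp.continuous_apply 2 _ j).measurable.comp hH.measurable_fun)
    fun k p => enorm_apply_le (H k p) j

variable [NormedAddCommGroup V] [NormedSpace ℂ V]

theorem fourierConv_zero_left (g : Wave d → V) (k : Wave d) :
    fourierConv (fun _ => 0) g k = 0 := by
  simp [fourierConv]

theorem fourierConv_zero_right (f : Wave d → ℂ) (k : Wave d) :
    fourierConv f (fun _ => (0 : V)) k = 0 := by
  simp [fourierConv]

theorem fourierConv_eq_add_restrictTime (hAB : Disjoint A B) {s t : ℝ} (hs : s ∈ A ∪ B)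
    (ht : t ∈ A ∪ B) (F : Wave d → ℝ → ℂ) (W : Wave d → ℝ → V) (k : Wave d) :
    fourierConv (F · s) (W · t) k
      = fourierConv (restrictTime A F · s) (restrictTime A W · t) k
        + fourierConv (restrictTime A F · s) (restrictTime B W · t) k
        + fourierConv (restrictTime B F · s) (restrictTime A W · t) k
        + fourierConv (restrictTime B F · s) (restrictTime B W · t) k := by
  rcases hs with hs | hs <;> rcases ht with ht | ht
  all_goals
    first | have hs' := disjoint_left.1 hAB hs | have hs' := disjoint_right.1 hAB hs
    first | have ht' := disjoint_left.1 hAB ht | have ht' := disjoint_right.1 hAB ht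
    simp only [restrictTime_of_mem hs, restrictTime_of_notMem hs', restrictTime_of_mem ht,
      restrictTime_of_notMem ht', fourierConv_zero_left, fourierConv_zero_right, add_zero,
      zero_add]

variable [MeasurableSpace V] [BorelSpace V] [SecondCountableTopology V] {N : FourierNorm}
  {F : Wave d → ℝ → ℂ} {W : Wave d → ℝ → V} {h h' : ℝ → ℝ≥0∞}

theorem IsMajorant.integrableOn_fourierConv_restrictTime (hF : IsMajorant N F h)
    (hW : IsMajorant N W h') (hN : N.Admissible d) (hA : MeasurableSet A) (hB : MeasurableSet B)
    {p : ℝ} (hfin : (h ⋆ₗ h') p < ∞) (k : Wave d) :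
    IntegrableOn (fun s => fourierConv (restrictTime A F · s) (restrictTime B W · (p - s)) k)
      (Ioc 0 p) :=
  (hF.restrict hA).integrableOn_fourierConv_sub (hW.restrict hB) hN
    ((lconvolution_mono (indicator_le_self A h) (indicator_le_self B h') p).trans_lt hfin) k

theorem IsMajorant.fourierLaplaceConv_eq_add_restrictTime (hF : IsMajorant N F h)
    (hW : IsMajorant N W h') (hN : N.Admissible d) (hA : MeasurableSet A) (hB : MeasurableSet B)
    (hAB : Disjoint A B) (hu : Ioi 0 ⊆ A ∪ B) {p : ℝ} (hp : 0 ≤ p) (hfin : (h ⋆ₗ h') p < ∞)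
    (k : Wave d) :
    fourierLaplaceConv F W k p
      = fourierLaplaceConv (restrictTime A F) (restrictTime A W) k p
        + fourierLaplaceConv (restrictTime A F) (restrictTime B W) k p
        + fourierLaplaceConv (restrictTime B F) (restrictTime A W) k p
        + fourierLaplaceConv (restrictTime B F) (restrictTime B W) k p := by
  have hAA := hF.integrableOn_fourierConv_restrictTime hW hN hA hA hfin k
  have hAB' := hF.integrableOn_fourierConv_restrictTime hW hN hA hB hfin k
  have hBA := hF.integrableOn_fourierConv_restrictTime hW hN hB hA hfin k
  have hBB := hF.integrableOn_fourierConv_restrictTime hW hN hB hB hfin k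
  simp only [fourierLaplaceConv, intervalIntegral.integral_of_le hp]
  rw [← integral_add' hAA hAB', ← integral_add' (hAA.add hAB') hBA,
    ← integral_add' ((hAA.add hAB').add hBA) hBB]
  refine setIntegral_congr_ae measurableSet_Ioc ?_
  filter_upwards [Measure.ae_ne volume p] with s hsp hs
  exact fourierConv_eq_add_restrictTime hAB (hu hs.1)
    (hu (sub_pos.2 (hs.2.lt_of_ne hsp))) F W k

end RestrictTime

section Nonlinearity

variable {d : ℕ} {V : Type*} [NormedAddCommGroup V] [NormedSpace ℂ V]

/-- The nonlinear term `û_{0,j} * Ŵ + Ĥ_j * ŵ₀ + Ĥ_j ** Ŵ`, of which `Ĝ_j^{[1]}` and `Ĝ_j^{[2]}`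
are the cases `Ŵ = Ĥ` (before projection) and `Ŵ = Ŝ`, up to sign. -/
noncomputable def nonlin (u₀ : Wave d → CVec d) (w₀ : Wave d → V) (H : Wave d → ℝ → CVec d)
    (W : Wave d → ℝ → V) (j : Fin d) (k : Wave d) (p : ℝ) : V :=
  fourierConv (u₀ · j) (W · p) k + fourierConv (H · p j) w₀ k
    + fourierLaplaceConv (fun q s => H q s j) W k p

theorem nonlin_known_eq_zero {p₀ p : ℝ} (hp₀ : 0 ≤ p₀) (hp : 2 * p₀ < p) (u₀ : Wave d → CVec d)
    (w₀ : Wave d → V) (H : Wave d → ℝ → CVec d) (W : Wave d → ℝ → V) (j : Fin d) (k : Wave d) :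
    nonlin u₀ w₀ (known p₀ H) (known p₀ W) j k p = 0 := by
  have hzero {s : ℝ} (hs : p₀ < s) : s ∉ Ioc 0 p₀ := fun h => h.2.not_gt hs
  have hconv : fourierLaplaceConv (restrictTime (Ioc 0 p₀) fun q s => H q s j)
      (restrictTime (Ioc 0 p₀) W) k p = 0 := by
    rw [fourierLaplaceConv, intervalIntegral.integral_of_le (by linarith)]
    refine setIntegral_eq_zero_of_forall_eq_zero fun s _ => ?_
    rcases lt_or_ge p₀ s with hs | hs
    · simp only [restrictTime_of_notMem (hzero hs), fourierConv_zero_left]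
    · simp only [restrictTime_of_notMem (hzero (show p₀ < p - s by linarith)),
        fourierConv_zero_right]
  simp only [nonlin, known_eq_restrictTime, restrictTime_coord, hconv]
  simp only [restrictTime_of_notMem (hzero (show p₀ < p by linarith)), fourierConv_zero_right,
    fourierConv_zero_left, add_zero]

/-- The sum of `k_j` times the difference between the nonlinear term and the one formed with the
known parts of `Ĥ` and `Ŵ`. -/
noncomputable def convectionTail (p₀ : ℝ) (u₀ : Wave d → CVec d) (w₀ : Wave d → V)
    (H : Wave d → ℝ → CVec d) (W : Wave d → ℝ → V) (k : Wave d) (p : ℝ) : V :=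
  ∑ j, (k j : ℂ) •
    (nonlin u₀ w₀ H W j k p - nonlin u₀ w₀ (known p₀ H) (known p₀ W) j k p)

variable [MeasurableSpace V] [BorelSpace V] [SecondCountableTopology V] {N : FourierNorm}
  {u₀ : Wave d → CVec d} {w₀ : Wave d → V} {H : Wave d → ℝ → CVec d} {W : Wave d → ℝ → V}
  {h h' : ℝ → ℝ≥0∞}

theorem IsMajorant.nonlin_sub_known (hH : IsMajorant N H h) (hW : IsMajorant N W h')
    (hN : N.Admissible d) {p₀ p : ℝ} (hp : 0 < p) (hfin : (h ⋆ₗ h') p < ∞) (j : Fin d)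
    (k : Wave d) :
    nonlin u₀ w₀ H W j k p - nonlin u₀ w₀ (known p₀ H) (known p₀ W) j k p
      = nonlin u₀ w₀ (restrictTime (Ioi p₀) H) (restrictTime (Ioi p₀) W) j k p
        + fourierLaplaceConv (fun q s => restrictTime (Ioc 0 p₀) H q s j)
            (restrictTime (Ioi p₀) W) k p
        + fourierLaplaceConv (fun q s => restrictTime (Ioi p₀) H q s j)
            (restrictTime (Ioc 0 p₀) W) k p := by
  have hdisj : Disjoint (Ioc 0 p₀) (Ioi p₀) :=
    disjoint_left.2 fun s hs hs' => hs.2.not_gt hs'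
  have hcover : Ioi 0 ⊆ Ioc 0 p₀ ∪ Ioi p₀ := fun s hs =>
    (le_or_gt s p₀).imp (fun h => ⟨hs, h⟩) id
  simp only [nonlin, known_eq_restrictTime, restrictTime_coord]
  rw [(hH.coord j).fourierLaplaceConv_eq_add_restrictTime hW hN measurableSet_Ioc
    measurableSet_Ioi hdisj hcover hp.le hfin k]
  rcases hcover hp with hmem | hmem
  · have hmem' := disjoint_left.1 hdisj hmem
    simp only [restrictTime_of_mem hmem, restrictTime_of_notMem hmem', fourierConv_zero_left,
      fourierConv_zero_right]
    abel
  · have hmem' := disjoint_right.1 hdisj hmem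
    simp only [restrictTime_of_mem hmem, restrictTime_of_notMem hmem', fourierConv_zero_left,
      fourierConv_zero_right]
    abel

theorem IsMajorant.integrableOn_nonlin (hH : IsMajorant N H h) (hW : IsMajorant N W h')
    (hN : N.Admissible d) (hu₀ : Measurable u₀) (hu₀t : N.enrm (‖u₀ ·‖ₑ) < ∞)
    (hw₀ : Measurable w₀) (hw₀t : N.enrm (‖w₀ ·‖ₑ) < ∞) (j : Fin d) (k : Wave d) (L : ℝ) :
    IntegrableOn (nonlin u₀ w₀ H W j k) (Ioc 0 L) :=
  ((hW.integrableOn_fourierConv_left hN (by fun_prop)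
      ((FourierNorm.enrm_mono fun k => enorm_apply_le (u₀ k) j).trans_lt hu₀t) k L).add
    ((hH.coord j).integrableOn_fourierConv_right hN hw₀ hw₀t k L)).add
    ((hH.coord j).integrableOn_fourierLaplaceConv hW hN k L)

end Nonlinearity

/-! ### Bounds for the unknown part of the nonlinearity -/

section Convective

variable {d : ℕ} {V W : Type*} [NormedAddCommGroup V] [NormedSpace ℂ V] [CompleteSpace V]
  [NormedAddCommGroup W] [NormedSpace ℂ W] [CompleteSpace W]

section FourierConv

variable [MeasurableSpace V] [BorelSpace V] [SecondCountableTopology V]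
  [MeasurableSpace W] [BorelSpace W] [SecondCountableTopology W]

theorem enormPair_sum_fourierConv_le {f : Wave d → CVec d} {g : Wave d → V} {g' : Wave d → W}
    (hf : Measurable f) (hg : Measurable g) (hg' : Measurable g') (k : Wave d) :
    enormPair (∑ j, (k j : ℂ) • fourierConv (f · j) g k)
        (∑ j, (k j : ℂ) • fourierConv (f · j) g' k)
      ≤ ‖k‖ₑ * ((‖f ·‖ₑ) ⋆ₗ fun q => enormPair (g q) (g' q)) k := by
  rcases eq_or_ne k 0 with rfl | hk
  · simp
  rcases eq_or_ne (((‖f ·‖ₑ) ⋆ₗ fun q => enormPair (g q) (g' q)) k) ∞ with hfin | hfin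
  · rw [hfin, ENNReal.mul_top (by simpa using hk)]
    exact le_top
  simp only [lconvolution_def, neg_add_eq_sub] at hfin ⊢
  have hi (j : Fin d) : Integrable fun q => f q j • g (k - q) := by
    refine ⟨Measurable.aestronglyMeasurable (by fun_prop),
      (lintegral_mono fun q => ?_).trans_lt hfin.lt_top⟩
    rw [enorm_smul]
    exact mul_le_mul' (enorm_apply_le _ _) (enorm_fst_le_enormPair _ _)
  have hi' (j : Fin d) : Integrable fun q => f q j • g' (k - q) := by
    refine ⟨Measurable.aestronglyMeasurable (by fun_prop),
      (lintegral_mono fun q => ?_).trans_lt hfin.lt_top⟩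
    rw [enorm_smul]
    exact mul_le_mul' (enorm_apply_le _ _) (enorm_snd_le_enormPair _ _)
  refine (enormPair_sum_integral_le (fun j => (k j : ℂ)) hi hi').trans ?_
  rw [← lintegral_const_mul' _ _ enorm_ne_top]
  refine lintegral_mono fun q => ?_
  simp only [smul_smul, ← Finset.sum_smul, enormPair_smul, ← mul_assoc]
  gcongr
  exact enorm_sum_mul_le k (f q)

end FourierConv

/-- The analogue of `fourierLaplaceConv` for functions with values in `[0, ∞]`. -/
noncomputable def fourierLaplaceLConv (U U' : Wave d → ℝ → ℝ≥0∞) (k : Wave d) (p : ℝ) : ℝ≥0∞ :=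
  ∫⁻ s in Ioc 0 p, ((U · s) ⋆ₗ (U' · (p - s))) k

section LConv

variable {U U' Z Z' : Wave d → ℝ → ℝ≥0∞}

theorem fourierLaplaceLConv_mono (hU : ∀ q s, U q s ≤ Z q s) (hU' : ∀ q s, U' q s ≤ Z' q s)
    (k : Wave d) (p : ℝ) : fourierLaplaceLConv U U' k p ≤ fourierLaplaceLConv Z Z' k p :=
  lintegral_mono fun s => lconvolution_mono (hU · s) (hU' · (p - s)) k

theorem measurable_fourierLaplaceLConv (hU : Measurable (Function.uncurry U))
    (hU' : Measurable (Function.uncurry U')) :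
    Measurable (Function.uncurry (fourierLaplaceLConv U U')) :=
  measurable_setLIntegral_Ioc_zero
    (f := fun x : (Wave d × ℝ) × ℝ => ((U · x.2) ⋆ₗ (U' · (x.1.2 - x.2))) x.1.1)
    (measurable_lconvolution_apply hU hU' (by fun_prop) (by fun_prop) (by fun_prop)) (by fun_prop)

theorem IsMajorant.enrm_fourierLaplaceLConv_le {N : FourierNorm} {h h' : ℝ → ℝ≥0∞}
    (hU : IsMajorant N U h) (hU' : IsMajorant N U' h') (hN : N.Admissible d) (p : ℝ) :
    N.enrm (fourierLaplaceLConv U U' · p) ≤ N.C0 d * (h ⋆ₗ h') p :=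
  calc N.enrm (fourierLaplaceLConv U U' · p)
      ≤ ∫⁻ s in Ioc 0 p, N.enrm ((U · s) ⋆ₗ (U' · (p - s))) :=
        FourierNorm.enrm_lintegral_le _ <| measurable_lconvolution_apply hU.measurable_fun
          hU'.measurable_fun measurable_fst measurable_snd (by fun_prop)
    _ ≤ ∫⁻ s in Ioc 0 p, N.C0 d * (N.enrm (U · s) * N.enrm (U' · (p - s))) :=
        lintegral_mono fun s => FourierNorm.enrm_lconvolution_le hN
          hU.measurable_fun.of_uncurry_right hU'.measurable_fun.of_uncurry_right
    _ ≤ N.C0 d * (h ⋆ₗ h') p := by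
        rw [lintegral_const_mul' _ _ (FourierNorm.C0_lt_top hN).ne]
        gcongr
        exact hU.setLIntegral_enrm_mul_enrm_le hU' p

end LConv

theorem enormPair_sum_fourierLaplaceConv_le [MeasurableSpace V] [BorelSpace V]
    [SecondCountableTopology V] [MeasurableSpace W] [BorelSpace W] [SecondCountableTopology W]
    {F : Wave d → ℝ → CVec d} {G : Wave d → ℝ → V} {G' : Wave d → ℝ → W}
    (hF : Measurable (Function.uncurry F)) (hG : Measurable (Function.uncurry G))
    (hG' : Measurable (Function.uncurry G')) {k : Wave d} {p : ℝ} (hp : 0 ≤ p)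
    (hi : ∀ j, IntegrableOn (fun s => fourierConv (F · s j) (G · (p - s)) k) (Ioc 0 p))
    (hi' : ∀ j, IntegrableOn (fun s => fourierConv (F · s j) (G' · (p - s)) k) (Ioc 0 p)) :
    enormPair (∑ j, (k j : ℂ) • fourierLaplaceConv (fun q s => F q s j) G k p)
        (∑ j, (k j : ℂ) • fourierLaplaceConv (fun q s => F q s j) G' k p)
      ≤ ‖k‖ₑ * fourierLaplaceLConv (fun q s => ‖F q s‖ₑ)
          (fun q s => enormPair (G q s) (G' q s)) k p := by
  simp only [fourierLaplaceConv, intervalIntegral.integral_of_le hp]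
  refine (enormPair_sum_integral_le (fun j => (k j : ℂ)) hi hi').trans ?_
  rw [fourierLaplaceLConv, ← lintegral_const_mul' _ _ enorm_ne_top]
  exact lintegral_mono fun s => enormPair_sum_fourierConv_le hF.of_uncurry_right
    hG.of_uncurry_right hG'.of_uncurry_right k

/-- The majorant of `convectionTail` divided by `|k|`, for a pair with modulus `U` and initial
data with modulus `U₀`. -/
noncomputable def tailMajorant (p₀ : ℝ) (U₀ : Wave d → ℝ≥0∞) (U : Wave d → ℝ → ℝ≥0∞)
    (k : Wave d) (p : ℝ) : ℝ≥0∞ :=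
  (U₀ ⋆ₗ (restrictTime (Ioi p₀) U · p)) k + ((restrictTime (Ioi p₀) U · p) ⋆ₗ U₀) k
    + fourierLaplaceLConv (restrictTime (Ioi p₀) U) (restrictTime (Ioi p₀) U) k p
    + fourierLaplaceLConv (restrictTime (Ioc 0 p₀) U) (restrictTime (Ioi p₀) U) k p
    + fourierLaplaceLConv (restrictTime (Ioi p₀) U) (restrictTime (Ioc 0 p₀) U) k p

theorem tailMajorant_eq_zero {p₀ p : ℝ} (hp : p ≤ p₀) (U₀ : Wave d → ℝ≥0∞)
    (U : Wave d → ℝ → ℝ≥0∞) (k : Wave d) : tailMajorant p₀ U₀ U k p = 0 := by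
  have hzero {s : ℝ} (hs : s ≤ p) (q : Wave d) : restrictTime (Ioi p₀) U q s = 0 :=
    restrictTime_of_notMem (hs.trans hp).not_gt U q
  have hleft (U' : Wave d → ℝ → ℝ≥0∞) :
      fourierLaplaceLConv (restrictTime (Ioi p₀) U) U' k p = 0 :=
    (setLIntegral_congr_fun measurableSet_Ioc fun s hs => by
      simp [lconvolution_def, hzero hs.2]).trans lintegral_zero
  have hright (U' : Wave d → ℝ → ℝ≥0∞) :
      fourierLaplaceLConv U' (restrictTime (Ioi p₀) U) k p = 0 :=
    (setLIntegral_congr_fun measurableSet_Ioc fun s hs => by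
      simp [lconvolution_def, hzero (sub_le_self p hs.1.le)]).trans lintegral_zero
  simp [tailMajorant, hleft, hright, lconvolution_def, hzero le_rfl]

theorem measurable_tailMajorant (p₀ : ℝ) {U₀ : Wave d → ℝ≥0∞} {U : Wave d → ℝ → ℝ≥0∞}
    (hU₀ : Measurable U₀) (hU : Measurable (Function.uncurry U)) :
    Measurable (Function.uncurry (tailMajorant p₀ U₀ U)) := by
  have hT := measurable_restrictTime (measurableSet_Ioi (a := p₀)) hU
  have hK := measurable_restrictTime (measurableSet_Ioc (a := 0) (b := p₀)) hU
  have hU₀' : Measurable (Function.uncurry fun q (_ : ℝ) => U₀ q) := hU₀.comp measurable_fst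
  exact ((((measurable_lconvolution_apply hU₀' hT measurable_fst measurable_snd
      measurable_snd).add (measurable_lconvolution_apply hT hU₀' measurable_fst measurable_snd
      measurable_snd)).add (measurable_fourierLaplaceLConv hT hT)).add
    (measurable_fourierLaplaceLConv hK hT)).add (measurable_fourierLaplaceLConv hT hK)

variable {N : FourierNorm} {H : Wave d → ℝ → CVec d} {S : Wave d → ℝ → ℂ} {h : ℝ → ℝ≥0∞}

theorem IsMajorant.enormPair_sum_fourierLaplaceConv_restrictTime_le
    (hU : IsMajorant N (fun k p => enormPair (H k p) (S k p)) h)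
    (hH : Measurable (Function.uncurry H)) (hS : Measurable (Function.uncurry S))
    (hN : N.Admissible d) {A B : Set ℝ} (hA : MeasurableSet A) (hB : MeasurableSet B) {p : ℝ}
    (hp : 0 ≤ p) (hfin : (h ⋆ₗ h) p < ∞) (k : Wave d) :
    enormPair
        (∑ j, (k j : ℂ) • fourierLaplaceConv (fun q s => restrictTime A H q s j)
          (restrictTime B H) k p)
        (∑ j, (k j : ℂ) • fourierLaplaceConv (fun q s => restrictTime A H q s j)
          (restrictTime B S) k p)
      ≤ ‖k‖ₑ * fourierLaplaceLConv (restrictTime A fun k p => enormPair (H k p) (S k p))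
          (restrictTime B fun k p => enormPair (H k p) (S k p)) k p := by
  have hMH : IsMajorant N H h := hU.of_enorm_le hH fun k p => enorm_fst_le_enormPair _ _
  have hMS : IsMajorant N S h := hU.of_enorm_le hS fun k p => enorm_snd_le_enormPair _ _
  refine (enormPair_sum_fourierLaplaceConv_le (measurable_restrictTime hA hH)
    (measurable_restrictTime hB hH) (measurable_restrictTime hB hS) hp (fun j => ?_)
    fun j => ?_).trans ?_
  · simp only [restrictTime_coord]
    exact (hMH.coord j).integrableOn_fourierConv_restrictTime hMH hN hA hB hfin k
  · simp only [restrictTime_coord]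
    exact (hMH.coord j).integrableOn_fourierConv_restrictTime hMS hN hA hB hfin k
  · gcongr
    refine fourierLaplaceLConv_mono (fun q s => ?_)
      (fun q s => (enormPair_restrictTime B H S q s).le) k p
    exact (enorm_fst_le_enormPair _ _).trans_eq (enormPair_restrictTime A H S q s)

theorem IsMajorant.enormPair_convectionTail_le
    (hU : IsMajorant N (fun k p => enormPair (H k p) (S k p)) h)
    (hH : Measurable (Function.uncurry H)) (hS : Measurable (Function.uncurry S))
    (hN : N.Admissible d) {u₀ : Wave d → CVec d} {Θ₀ : Wave d → ℂ} (hu₀ : Measurable u₀)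
    (hΘ₀ : Measurable Θ₀) {p₀ p : ℝ} (hp : 0 < p) (hfin : (h ⋆ₗ h) p < ∞) (k : Wave d) :
    enormPair (convectionTail p₀ u₀ u₀ H H k p) (convectionTail p₀ u₀ Θ₀ H S k p)
      ≤ ‖k‖ₑ * tailMajorant p₀ (fun k => enormPair (u₀ k) (Θ₀ k))
          (fun k p => enormPair (H k p) (S k p)) k p := by
  have hMH : IsMajorant N H h := hU.of_enorm_le hH fun k p => enorm_fst_le_enormPair _ _
  have hMS : IsMajorant N S h := hU.of_enorm_le hS fun k p => enorm_snd_le_enormPair _ _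
  have hT : MeasurableSet (Ioi p₀) := measurableSet_Ioi
  have hTH := (measurable_restrictTime hT hH).of_uncurry_right (y := p)
  have hTS := (measurable_restrictTime hT hS).of_uncurry_right (y := p)
  have hlaplace {A B : Set ℝ} (hA : MeasurableSet A) (hB : MeasurableSet B) :=
    hU.enormPair_sum_fourierLaplaceConv_restrictTime_le hH hS hN hA hB hp.le hfin k
  simp only [convectionTail, hMH.nonlin_sub_known hMH hN hp hfin,
    hMH.nonlin_sub_known hMS hN hp hfin]
  simp only [nonlin, smul_add, Finset.sum_add_distrib, tailMajorant, mul_add]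
  refine (enormPair_add_le _ _ _ _).trans (add_le_add ((enormPair_add_le _ _ _ _).trans
    (add_le_add ((enormPair_add_le _ _ _ _).trans (add_le_add ((enormPair_add_le _ _ _ _).trans
    (add_le_add ?_ ?_)) (hlaplace hT hT))) (hlaplace measurableSet_Ioc hT)))
    (hlaplace hT measurableSet_Ioc))
  · refine (enormPair_sum_fourierConv_le hu₀ hTH hTS k).trans ?_
    gcongr
    exact lconvolution_mono (fun q => enorm_fst_le_enormPair _ _)
      (fun q => (enormPair_restrictTime _ H S q p).le) k
  · refine (enormPair_sum_fourierConv_le hTH hu₀ hΘ₀ k).trans ?_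
    gcongr
    exact lconvolution_mono (fun q => (enorm_fst_le_enormPair _ _).trans_eq
      (enormPair_restrictTime _ H S q p)) le_rfl k

end Convective

/-! ### The difference of the solution and its known part -/

section Difference

variable {d : ℕ} {V : Type*} [NormedAddCommGroup V] [NormedSpace ℂ V]

theorem enorm_ofReal_complex (x : ℝ) : ‖(x : ℂ)‖ₑ = ‖x‖ₑ := by
  rw [← ofReal_norm, Complex.norm_real, ofReal_norm]

theorem integrableOn_borelKernel_smul {κ : ℝ} (hκ : 0 < κ) (k : Wave d) {p : ℝ} (hp : 0 < p)
    {f : ℝ → V} (hf : IntegrableOn f (Ioc 0 p)) :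
    IntegrableOn (fun p' => (borelKernel κ k p p' : ℂ) • f p') (Ioc 0 p) := by
  have hmeas : AEStronglyMeasurable (fun p' => (borelKernel κ k p p' : ℂ))
      (volume.restrict (Ioc 0 p)) :=
    ((Complex.continuous_ofReal.comp_continuousOn (continuousOn_borelKernel hκ k hp)).mono
      Ioc_subset_Ioi_self).aestronglyMeasurable measurableSet_Ioc
  refine hf.bdd_smul 1 hmeas ?_
  filter_upwards [ae_restrict_mem measurableSet_Ioc] with p' hp'
  rw [Complex.norm_real]
  exact abs_borelKernel_le_one hκ k hp'.1 hp'.2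

theorem intervalIntegral_min_eq_setIntegral_Ioc {f : ℝ → V} {p m : ℝ} (hp : 0 ≤ p) (hm : 0 ≤ m)
    (hf : ∀ x, m < x → f x = 0) : ∫ x in (0 : ℝ)..min p m, f x = ∫ x in Ioc 0 p, f x := by
  rw [intervalIntegral.integral_of_le (le_min hp hm)]
  refine (setIntegral_eq_of_subset_of_forall_sdiff_eq_zero measurableSet_Ioc
    (Ioc_subset_Ioc_right (min_le_left p m)) fun x hx => hf x ?_).symm
  by_contra! hxm
  exact hx.2 ⟨hx.1.1, le_min hx.1.2 hxm⟩

variable [MeasurableSpace V] [BorelSpace V] [SecondCountableTopology V] {N : FourierNorm}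
  {u₀ : Wave d → CVec d} {w₀ : Wave d → V} {H : Wave d → ℝ → CVec d} {W : Wave d → ℝ → V}
  {h h' : ℝ → ℝ≥0∞}

theorem IsMajorant.integrableOn_convectionTail (hH : IsMajorant N H h) (hW : IsMajorant N W h')
    (hN : N.Admissible d) (hu₀ : Measurable u₀) (hu₀t : N.enrm (‖u₀ ·‖ₑ) < ∞)
    (hw₀ : Measurable w₀) (hw₀t : N.enrm (‖w₀ ·‖ₑ) < ∞) (p₀ : ℝ) (k : Wave d) (L : ℝ) :
    IntegrableOn (convectionTail p₀ u₀ w₀ H W k) (Ioc 0 L) :=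
  integrable_sum_smul _ fun j =>
    (hH.integrableOn_nonlin hW hN hu₀ hu₀t hw₀ hw₀t j k L).sub
      ((hH.knownPart p₀).integrableOn_nonlin (hW.knownPart p₀) hN hu₀ hu₀t hw₀ hw₀t j k L)

theorem IsMajorant.convection_sub_known [CompleteSpace V] (hH : IsMajorant N H h)
    (hW : IsMajorant N W h') (hN : N.Admissible d) (hu₀ : Measurable u₀)
    (hu₀t : N.enrm (‖u₀ ·‖ₑ) < ∞) (hw₀ : Measurable w₀) (hw₀t : N.enrm (‖w₀ ·‖ₑ) < ∞)
    (P : V →L[ℂ] V) {κ : ℝ} (hκ : 0 < κ) {p₀ p : ℝ} (hp₀ : 0 ≤ p₀) (hp : 0 < p) (k : Wave d) :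
    (∑ j, (Complex.I * (k j : ℂ)) • ∫ p' in (0 : ℝ)..p,
        (borelKernel κ k p p' : ℂ) • -P (nonlin u₀ w₀ H W j k p'))
      - (∑ j, (Complex.I * (k j : ℂ)) • ∫ p' in (0 : ℝ)..min p (2 * p₀),
        (borelKernel κ k p p' : ℂ) • -P (nonlin u₀ w₀ (known p₀ H) (known p₀ W) j k p'))
      = ∫ p' in Ioc 0 p, (borelKernel κ k p p' : ℂ) •
        -(Complex.I • P (convectionTail p₀ u₀ w₀ H W k p')) := by
  have hint {H : Wave d → ℝ → CVec d} {W : Wave d → ℝ → V} {h h' : ℝ → ℝ≥0∞}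
      (hH : IsMajorant N H h) (hW : IsMajorant N W h') (j : Fin d) :
      IntegrableOn (fun p' => (borelKernel κ k p p' : ℂ) • -P (nonlin u₀ w₀ H W j k p'))
        (Ioc 0 p) :=
    integrableOn_borelKernel_smul hκ k hp
      (P.integrable_comp (hH.integrableOn_nonlin hW hN hu₀ hu₀t hw₀ hw₀t j k p)).neg
  have hdiff (j : Fin d) := (hint hH hW j).sub (hint (hH.knownPart p₀) (hW.knownPart p₀) j)
  have htrunc (j : Fin d) := intervalIntegral_min_eq_setIntegral_Ioc (m := 2 * p₀) hp.le
    (by positivity)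
    (f := fun p' => (borelKernel κ k p p' : ℂ) •
      -P (nonlin u₀ w₀ (known p₀ H) (known p₀ W) j k p'))
    fun x hx => by rw [nonlin_known_eq_zero hp₀ hx, map_zero, neg_zero, smul_zero]
  simp only [htrunc, intervalIntegral.integral_of_le hp.le, ← Finset.sum_sub_distrib]
  refine (Finset.sum_congr rfl fun j _ => ?_).trans
    ((sum_smul_integral (fun j => Complex.I * (k j : ℂ)) hdiff).trans
      (integral_congr_ae (.of_forall fun p' => ?_)))
  · rw [← smul_sub, integral_sub' (hint hH hW j) (hint (hH.knownPart p₀) (hW.knownPart p₀) j)]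
  · simp only [convectionTail, map_sum, map_smul, map_sub, Finset.smul_sum,
      ← Finset.sum_neg_distrib, Pi.sub_apply]
    refine Finset.sum_congr rfl fun j _ => ?_
    module

end Difference

section Buoyancy

variable {d : ℕ} {N : FourierNorm} {S : Wave d → ℝ → ℂ} {h : ℝ → ℝ≥0∞}

theorem IsMajorant.integrableOn_hodge_scaleVec (hS : IsMajorant N S h) (hN : N.Admissible d)
    (e k : Wave d) (L : ℝ) : IntegrableOn (fun p => hodge k (scaleVec e (S k p))) (Ioc 0 L) := by
  simp only [hodge_scaleVec]
  exact (hS.integrableOn hN k L).smul_const _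

theorem IsMajorant.buoyancy_sub_known (hS : IsMajorant N S h) (hN : N.Admissible d)
    (e : Wave d) {κ : ℝ} (hκ : 0 < κ) {p₀ p : ℝ} (hp₀ : 0 ≤ p₀) (hp : 0 < p) (k : Wave d) :
    (∫ p' in (0 : ℝ)..p, (borelKernel κ k p p' : ℂ) • hodge k (scaleVec e (S k p')))
      - (∫ p' in (0 : ℝ)..min p p₀,
          (borelKernel κ k p p' : ℂ) • hodge k (scaleVec e (known p₀ S k p')))
      = ∫ p' in Ioc 0 p, (borelKernel κ k p p' : ℂ) •
          hodge k (scaleVec e (restrictTime (Ioi p₀) S k p')) := by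
  have hint {T : Wave d → ℝ → ℂ} {h : ℝ → ℝ≥0∞} (hT : IsMajorant N T h) :=
    integrableOn_borelKernel_smul hκ k hp (hT.integrableOn_hodge_scaleVec hN e k p)
  rw [intervalIntegral.integral_of_le hp.le, intervalIntegral_min_eq_setIntegral_Ioc hp.le hp₀
    fun x hx => ?_, ← integral_sub (hint hS) (hint (hS.knownPart p₀))]
  · refine setIntegral_congr_fun measurableSet_Ioc fun x hx => ?_
    simp only [hodge_scaleVec, known_eq_restrictTime]
    rcases le_or_gt x p₀ with h | h
    · simp [restrictTime, hx.1, h]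
    · simp [restrictTime, h]
  · rw [known_eq_restrictTime, restrictTime_of_notMem fun h => h.2.not_gt hx, hodge_scaleVec,
      zero_smul, smul_zero]

end Buoyancy

section Tail

variable {d : ℕ} {N : FourierNorm} {D : Data d} {H : Wave d → ℝ → CVec d} {S : Wave d → ℝ → ℂ}
  {h : ℝ → ℝ≥0∞} {p₀ : ℝ}

/-- The integrand of `Ĥ - Ĥ^{(s)}`, without the Bessel kernel. -/
noncomputable def velocityTail (D : Data d) (H : Wave d → ℝ → CVec d) (S : Wave d → ℝ → ℂ)
    (p₀ : ℝ) (k : Wave d) (p : ℝ) : CVec d :=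
  -(Complex.I • hodge k (convectionTail p₀ D.u0 D.u0 H H k p))
    + (D.a : ℂ) • hodge k (scaleVec D.e (restrictTime (Ioi p₀) S k p))

/-- The integrand of `Ŝ - Ŝ^{(s)}`, without the Bessel kernel. -/
noncomputable def temperatureTail (D : Data d) (H : Wave d → ℝ → CVec d) (S : Wave d → ℝ → ℂ)
    (p₀ : ℝ) (k : Wave d) (p : ℝ) : ℂ :=
  -(Complex.I • convectionTail p₀ D.u0 D.Θ0 H S k p)

theorem IsMajorant.integrableOn_hodge_convectionTail (hH : IsMajorant N H h)
    (hN : N.Admissible d) (hu₀ : Measurable D.u0) (hu₀t : N.enrm (‖D.u0 ·‖ₑ) < ∞) (p₀ : ℝ)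
    (k : Wave d) (L : ℝ) :
    IntegrableOn (fun p => -(Complex.I • hodge k (convectionTail p₀ D.u0 D.u0 H H k p)))
      (Ioc 0 L) := by
  simp only [← hodgeL_apply]
  exact (((hodgeL k).integrable_comp
    (hH.integrableOn_convectionTail hH hN hu₀ hu₀t hu₀ hu₀t p₀ k L)).fun_smul Complex.I).fun_neg

theorem IsMajorant.integrableOn_buoyancyTail (hS : IsMajorant N S h) (hN : N.Admissible d)
    (D : Data d) (p₀ : ℝ) (k : Wave d) (L : ℝ) :
    IntegrableOn (fun p => (D.a : ℂ) • hodge k (scaleVec D.e (restrictTime (Ioi p₀) S k p)))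
      (Ioc 0 L) :=
  ((hS.restrict measurableSet_Ioi).integrableOn_hodge_scaleVec hN D.e k L).fun_smul _

theorem IsMajorant.velocityRHS_sub_Hs {h' : ℝ → ℝ≥0∞} (hH : IsMajorant N H h)
    (hS : IsMajorant N S h') (hN : N.Admissible d) (hν : 0 < D.ν) (hu₀ : Measurable D.u0)
    (hu₀t : N.enrm (‖D.u0 ·‖ₑ) < ∞) (hp₀ : 0 ≤ p₀) {p : ℝ} (hp : 0 < p) (k : Wave d) :
    velocityRHS D H S p p k p - Hs D H S p₀ k p
      = ∫ p' in Ioc 0 p, (borelKernel D.ν k p p' : ℂ) • velocityTail D H S p₀ k p' := by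
  have hconv := hH.convection_sub_known hH hN hu₀ hu₀t hu₀ hu₀t (hodgeL k) hν hp₀ hp k
  have hbuoy := hS.buoyancy_sub_known hN D.e hν hp₀ hp k
  have hintConv := integrableOn_borelKernel_smul hν k hp
    (hH.integrableOn_hodge_convectionTail hN hu₀ hu₀t p₀ k p)
  have hintBuoy := integrableOn_borelKernel_smul hν k hp
    (hS.integrableOn_buoyancyTail hN D p₀ k p)
  simp only [hodgeL_apply] at hconv
  simp only [velocityTail, smul_add]
  rw [integral_add hintConv hintBuoy, ← hconv]
  simp only [smul_comm _ (D.a : ℂ), integral_smul]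
  rw [← hbuoy, smul_sub]
  exact add_sub_add_right_eq_sub _ _ _ |>.trans (add_sub_add_comm _ _ _ _)

theorem IsMajorant.temperatureRHS_sub_Ss {h' : ℝ → ℝ≥0∞} (hH : IsMajorant N H h)
    (hS : IsMajorant N S h') (hN : N.Admissible d) (hμ : 0 < D.μ) (hu₀ : Measurable D.u0)
    (hu₀t : N.enrm (‖D.u0 ·‖ₑ) < ∞) (hΘ₀ : Measurable D.Θ0) (hΘ₀t : N.enrm (‖D.Θ0 ·‖ₑ) < ∞)
    (hp₀ : 0 ≤ p₀) {p : ℝ} (hp : 0 < p) (k : Wave d) :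
    temperatureRHS D H S p k p - Ss D H S p₀ k p
      = ∫ p' in Ioc 0 p, (borelKernel D.μ k p p' : ℂ) • temperatureTail D H S p₀ k p' :=
  (add_sub_add_right_eq_sub _ _ _).trans
    (hH.convection_sub_known hS hN hu₀ hu₀t hΘ₀ hΘ₀t (.id ℂ ℂ) hμ hp₀ hp k)

theorem IsMajorant.enormPair_tail_le (hU : IsMajorant N (fun k p => enormPair (H k p) (S k p)) h)
    (hH : Measurable (Function.uncurry H)) (hS : Measurable (Function.uncurry S))
    (hN : N.Admissible d) (hu₀ : Measurable D.u0) (hΘ₀ : Measurable D.Θ0) (ha : 0 ≤ D.a)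
    (he : ‖D.e‖ = 1) {p : ℝ} (hp : 0 < p) (hfin : (h ⋆ₗ h) p < ∞) (k : Wave d) :
    enormPair (velocityTail D H S p₀ k p) (temperatureTail D H S p₀ k p)
      ≤ ‖k‖ₑ * tailMajorant p₀ (fun k => enormPair (D.u0 k) (D.Θ0 k))
          (fun k p => enormPair (H k p) (S k p)) k p
        + ENNReal.ofReal D.a * ‖restrictTime (Ioi p₀) S k p‖ₑ := by
  have hbuoy : ‖(D.a : ℂ) • hodge k (scaleVec D.e (restrictTime (Ioi p₀) S k p))‖ₑ
      ≤ ENNReal.ofReal D.a * ‖restrictTime (Ioi p₀) S k p‖ₑ := by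
    rw [enorm_smul, enorm_ofReal_complex, Real.enorm_of_nonneg ha]
    gcongr
    refine (enorm_hodge_scaleVec_le _ _ _).trans_eq ?_
    rw [← ofReal_norm D.e, he, ENNReal.ofReal_one, one_mul]
  rw [velocityTail, temperatureTail, ← add_zero (-(Complex.I • convectionTail _ _ D.Θ0 _ _ _ _))]
  refine (enormPair_add_le _ _ _ _).trans (add_le_add ((enormPair_mono ?_ ?_).trans
    (hU.enormPair_convectionTail_le hH hS hN hu₀ hΘ₀ hp hfin k)) ?_)
  · rw [norm_neg, norm_smul, Complex.norm_I, one_mul]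
    exact norm_hodge_le _ _
  · rw [norm_neg, norm_smul, Complex.norm_I, one_mul]
  · rwa [enormPair_zero_right]

/-- The majorant of the integrand of `(Ĥ, Ŝ) - (Ĥ, Ŝ)^{(s)}`, with the Bessel kernel replaced by
its supremum. -/
noncomputable def sourceMajorant (D : Data d) (H : Wave d → ℝ → CVec d) (S : Wave d → ℝ → ℂ)
    (p₀ : ℝ) (k : Wave d) (p : ℝ) : ℝ≥0∞ :=
  (⨆ k : Wave d, ‖k‖ₑ * kernelSup D p₀ k) *
      tailMajorant p₀ (fun k => enormPair (D.u0 k) (D.Θ0 k))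
        (fun k p => enormPair (H k p) (S k p)) k p
    + (ENNReal.ofReal D.a * ⨆ k : Wave d, kernelSup D p₀ k) * enormPair (H k p) (S k p)

theorem IsMajorant.enormPair_kernel_tail_le
    (hU : IsMajorant N (fun k p => enormPair (H k p) (S k p)) h)
    (hH : Measurable (Function.uncurry H)) (hS : Measurable (Function.uncurry S))
    (hN : N.Admissible d) (hu₀ : Measurable D.u0) (hΘ₀ : Measurable D.Θ0) (ha : 0 ≤ D.a)
    (he : ‖D.e‖ = 1) (k : Wave d) {p p' : ℝ} (hp' : p' ∈ Ioc 0 p) (hfin : (h ⋆ₗ h) p' < ∞) :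
    enormPair ((borelKernel D.ν k p p' : ℂ) • velocityTail D H S p₀ k p')
        ((borelKernel D.μ k p p' : ℂ) • temperatureTail D H S p₀ k p')
      ≤ (Ioi p₀).indicator (sourceMajorant D H S p₀ k) p' := by
  have htail := hU.enormPair_tail_le (p₀ := p₀) hH hS hN hu₀ hΘ₀ ha he hp'.1 hfin k
  refine (enormPair_smul_le _ _ _ _).trans ?_
  simp only [enorm_ofReal_complex]
  rcases le_or_gt p' p₀ with h₀ | h₀
  · rw [tailMajorant_eq_zero h₀, restrictTime_of_notMem (notMem_Ioi.2 h₀), enorm_zero, mul_zero,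
      mul_zero, add_zero, nonpos_iff_eq_zero] at htail
    rw [htail, mul_zero]
    exact zero_le
  · rw [restrictTime_of_mem (mem_Ioi.2 h₀)] at htail
    rw [indicator_of_mem (mem_Ioi.2 h₀), sourceMajorant]
    calc _ ≤ kernelSup D p₀ k * (‖k‖ₑ * tailMajorant p₀ (fun k => enormPair (D.u0 k) (D.Θ0 k))
            (fun k p => enormPair (H k p) (S k p)) k p'
            + ENNReal.ofReal D.a * enormPair (H k p') (S k p')) :=
          mul_le_mul' (le_kernelSup D k h₀.le hp'.2)
            (htail.trans (by gcongr; exact enorm_snd_le_enormPair _ _))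
      _ = (‖k‖ₑ * kernelSup D p₀ k) * tailMajorant p₀ (fun k => enormPair (D.u0 k) (D.Θ0 k))
            (fun k p => enormPair (H k p) (S k p)) k p'
          + (ENNReal.ofReal D.a * kernelSup D p₀ k) * enormPair (H k p') (S k p') := by ring
      _ ≤ _ := by
          gcongr
          · exact le_iSup (fun k : Wave d => ‖k‖ₑ * kernelSup D p₀ k) k
          · exact le_iSup (kernelSup D p₀) k

theorem IsMajorant.enormPair_rhs_sub_le
    (hU : IsMajorant N (fun k p => enormPair (H k p) (S k p)) h)
    (hH : Measurable (Function.uncurry H)) (hS : Measurable (Function.uncurry S))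
    (hN : N.Admissible d) (hν : 0 < D.ν) (hμ : 0 < D.μ) (ha : 0 ≤ D.a) (he : ‖D.e‖ = 1)
    (hu₀ : Measurable D.u0) (hΘ₀ : Measurable D.Θ0)
    (hdata : N.enrm (fun k => enormPair (D.u0 k) (D.Θ0 k)) < ∞) (hp₀ : 0 ≤ p₀) {p : ℝ}
    (hp : 0 < p) (k : Wave d) :
    enormPair (velocityRHS D H S p p k p - Hs D H S p₀ k p)
        (temperatureRHS D H S p k p - Ss D H S p₀ k p)
      ≤ ∫⁻ p' in Ioc p₀ p, sourceMajorant D H S p₀ k p' := by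
  have hMH : IsMajorant N H h := hU.of_enorm_le hH fun k p => enorm_fst_le_enormPair _ _
  have hMS : IsMajorant N S h := hU.of_enorm_le hS fun k p => enorm_snd_le_enormPair _ _
  have hu₀t : N.enrm (‖D.u0 ·‖ₑ) < ∞ :=
    (FourierNorm.enrm_mono fun k => enorm_fst_le_enormPair _ _).trans_lt hdata
  have hΘ₀t : N.enrm (‖D.Θ0 ·‖ₑ) < ∞ :=
    (FourierNorm.enrm_mono fun k => enorm_snd_le_enormPair _ _).trans_lt hdata
  have hintV := integrableOn_borelKernel_smul hν k hp
    ((hMH.integrableOn_hodge_convectionTail hN hu₀ hu₀t p₀ k p).add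
      (hMS.integrableOn_buoyancyTail hN D p₀ k p))
  have hintT := integrableOn_borelKernel_smul hμ k hp
    ((hMH.integrableOn_convectionTail hMS hN hu₀ hu₀t hΘ₀ hΘ₀t p₀ k p).fun_smul Complex.I).fun_neg
  rw [hMH.velocityRHS_sub_Hs hMS hN hν hu₀ hu₀t hp₀ hp k,
    hMH.temperatureRHS_sub_Ss hMS hN hμ hu₀ hu₀t hΘ₀ hΘ₀t hp₀ hp k]
  refine (enormPair_integral_le hintV hintT).trans ?_
  have hsub : Ioc p₀ p = Ioi p₀ ∩ Ioc 0 p := by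
    rw [inter_comm, Ioc_inter_Ioi, max_eq_right hp₀]
  rw [hsub, ← Measure.restrict_restrict measurableSet_Ioi, ← lintegral_indicator measurableSet_Ioi]
  refine setLIntegral_mono_ae' measurableSet_Ioc ?_
  filter_upwards [hU.ae_lconvolution_lt_top hU] with p' hfin hp'
  exact hU.enormPair_kernel_tail_le hH hS hN hu₀ hΘ₀ ha he k hp' (hfin hp'.1)

end Tail

/-! ### The Volterra inequality for the norm of the solution -/

section Norm

variable {d : ℕ} {N : FourierNorm} {U : Wave d → ℝ → ℝ≥0∞} {U₀ : Wave d → ℝ≥0∞} {h : ℝ → ℝ≥0∞}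
  {D : Data d} {H : Wave d → ℝ → CVec d} {S : Wave d → ℝ → ℂ} {p₀ : ℝ}

theorem IsMajorant.ae_enrm_tailMajorant_le (hU : IsMajorant N U h) (hN : N.Admissible d)
    (hU₀ : Measurable U₀) (hp₀ : 0 ≤ p₀) :
    ∀ᵐ p, p₀ < p → N.enrm (tailMajorant p₀ U₀ U · p) ≤ N.C0 d *
      volterra (2 * N.enrm U₀) 1 ((Ioc 0 p₀).indicator h) ((Ioi p₀).indicator h) p := by
  have hT := hU.restrict (measurableSet_Ioi (a := p₀))
  have hK := hU.restrict (measurableSet_Ioc (a := 0) (b := p₀))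
  have hmLConv {U U' : Wave d → ℝ → ℝ≥0∞} {h h' : ℝ → ℝ≥0∞} (hU : IsMajorant N U h)
      (hU' : IsMajorant N U' h') (p : ℝ) : Measurable (fourierLaplaceLConv U U' · p) :=
    (measurable_fourierLaplaceLConv hU.measurable_fun hU'.measurable_fun).of_uncurry_right
  filter_upwards [hT.enrm_le] with p hp hpp
  have hTp : Measurable (restrictTime (Ioi p₀) U · p) := hT.measurable_fun.of_uncurry_right
  have hlin : N.enrm (restrictTime (Ioi p₀) U · p) ≤ (Ioi p₀).indicator h p := hp (hp₀.trans_lt hpp)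
  calc N.enrm (tailMajorant p₀ U₀ U · p)
      ≤ N.C0 d * (N.enrm U₀ * (Ioi p₀).indicator h p)
          + N.C0 d * ((Ioi p₀).indicator h p * N.enrm U₀)
          + N.C0 d * ((Ioi p₀).indicator h ⋆ₗ (Ioi p₀).indicator h) p
          + N.C0 d * ((Ioc 0 p₀).indicator h ⋆ₗ (Ioi p₀).indicator h) p
          + N.C0 d * ((Ioi p₀).indicator h ⋆ₗ (Ioc 0 p₀).indicator h) p := by
        refine FourierNorm.enrm_add_le_of_le (hmLConv hT hK p) (FourierNorm.enrm_add_le_of_le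
          (hmLConv hK hT p) (FourierNorm.enrm_add_le_of_le (hmLConv hT hT p)
          (FourierNorm.enrm_add_le_of_le (measurable_lconvolution _ hTp hU₀)
          ((FourierNorm.enrm_lconvolution_le hN hU₀ hTp).trans (by gcongr))
          ((FourierNorm.enrm_lconvolution_le hN hTp hU₀).trans (by gcongr)))
          (hT.enrm_fourierLaplaceLConv_le hT hN p)) (hK.enrm_fourierLaplaceLConv_le hT hN p))
          (hT.enrm_fourierLaplaceLConv_le hK hN p)
    _ = _ := by
        rw [volterra]
        ring

theorem B1_eq (N : FourierNorm) (D : Data d) (p₀ : ℝ) :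
    B1 N D p₀ = 2 * B3 N D p₀ * N.enrm fun k => enormPair (D.u0 k) (D.Θ0 k) := by
  simp only [B1, B3, FourierNorm.nrm_eq_enrm, enorm_pairAbs]

theorem IsMajorant.measurable_sourceMajorant
    (hU : IsMajorant N (fun k p => enormPair (H k p) (S k p)) h) (hu₀ : Measurable D.u0)
    (hΘ₀ : Measurable D.Θ0) (p₀ : ℝ) :
    Measurable (Function.uncurry (sourceMajorant D H S p₀)) :=
  ((measurable_tailMajorant p₀ (measurable_enormPair hu₀ hΘ₀) hU.measurable_fun).const_mul _).add
    (hU.measurable_fun.const_mul _)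

theorem IsMajorant.ae_enrm_sourceMajorant_le
    (hU : IsMajorant N (fun k p => enormPair (H k p) (S k p)) h) (hN : N.Admissible d)
    (hC0 : 1 ≤ N.C0 d) (hu₀ : Measurable D.u0) (hΘ₀ : Measurable D.Θ0) (hp₀ : 0 ≤ p₀) :
    ∀ᵐ p, p₀ < p → N.enrm (sourceMajorant D H S p₀ · p) ≤
      volterra (B1 N D p₀ + B4 N D p₀) (B3 N D p₀) ((Ioc 0 p₀).indicator h)
        ((Ioi p₀).indicator h) p := by
  have hU₀ := measurable_enormPair hu₀ hΘ₀
  have hT := measurable_tailMajorant p₀ hU₀ hU.measurable_fun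
  have hB4 : ENNReal.ofReal D.a * ⨆ k, kernelSup D p₀ k ≤ B4 N D p₀ := by
    rw [B4_eq, mul_left_comm]
    exact le_mul_of_one_le_left zero_le hC0
  filter_upwards [hU.ae_enrm_tailMajorant_le hN hU₀ hp₀, hU.enrm_le] with p htail hlin hp
  have hUp := hU.measurable_fun.of_uncurry_right (y := p)
  refine (FourierNorm.enrm_add_le_of_le (hUp.const_mul _)
    ((FourierNorm.enrm_const_mul_le _ hT.of_uncurry_right).trans (mul_le_mul_right (htail hp) _))
    ((FourierNorm.enrm_const_mul_le _ hUp).trans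
      (mul_le_mul' hB4 (hlin (hp₀.trans_lt hp))))).trans_eq ?_
  rw [volterra, volterra, indicator_of_mem (mem_Ioi.2 hp), B1_eq, B3_eq]
  ring

theorem IsMajorant.ae_le_add_volterra
    (hU : IsMajorant N (fun k p => enormPair (H k p) (S k p)) h) (hN : N.Admissible d)
    (hC0 : 1 ≤ N.C0 d) (hν : 0 < D.ν) (hμ : 0 < D.μ) (ha : 0 ≤ D.a) (he : ‖D.e‖ = 1)
    (hu₀ : Measurable D.u0) (hΘ₀ : Measurable D.Θ0)
    (hdata : N.enrm (fun k => enormPair (D.u0 k) (D.Θ0 k)) < ∞) (hsol : IsSolution D N H S)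
    (hp₀ : 0 ≤ p₀) :
    ∀ᵐ p ∂volume.restrict (Ioi p₀), N.enrm (fun k => enormPair (H k p) (S k p)) ≤
      N.enrm (fun k => enormPair (Hs D H S p₀ k p) (Ss D H S p₀ k p))
      + ∫⁻ p' in Ioc p₀ p, volterra (B1 N D p₀ + B4 N D p₀) (B3 N D p₀)
          ((Ioc 0 p₀).indicator h) ((Ioi p₀).indicator h) p' := by
  have hmeas := hU.measurable_sourceMajorant hu₀ hΘ₀ p₀
  have hsub : Ioi p₀ ⊆ Ioi 0 := Ioi_subset_Ioi hp₀
  filter_upwards [ae_mono (Measure.restrict_mono_set volume hsub) hsol.velocity_eq,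
    ae_mono (Measure.restrict_mono_set volume hsub) hsol.temperature_eq,
    ae_restrict_mem measurableSet_Ioi] with p hHp hSp hp
  have hpointwise (k : Wave d) : enormPair (H k p) (S k p)
      ≤ enormPair (Hs D H S p₀ k p) (Ss D H S p₀ k p)
        + ∫⁻ p' in Ioc p₀ p, sourceMajorant D H S p₀ k p' := by
    have hdiff := hU.enormPair_rhs_sub_le hsol.measurable_H hsol.measurable_S hN hν hμ ha he hu₀
      hΘ₀ hdata hp₀ (hsub hp) k
    rw [← hHp k, ← hSp k] at hdiff
    have hadd := enormPair_add_le (Hs D H S p₀ k p) (H k p - Hs D H S p₀ k p)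
      (Ss D H S p₀ k p) (S k p - Ss D H S p₀ k p)
    rw [add_sub_cancel, add_sub_cancel] at hadd
    exact hadd.trans (add_le_add_right hdiff _)
  refine (FourierNorm.enrm_mono hpointwise).trans (FourierNorm.enrm_add_le_of_le
    hmeas.lintegral_prod_right' le_rfl ((FourierNorm.enrm_lintegral_le _ hmeas).trans ?_))
  refine setLIntegral_mono_ae' measurableSet_Ioc ?_
  filter_upwards [hU.ae_enrm_sourceMajorant_le hN hC0 hu₀ hΘ₀ hp₀] with p' hsource hp'
  exact hsource hp'.1

end Norm

theorem mul_expWeight_le {ω₀ ω p₀ p : ℝ} (hω₀ : 0 ≤ ω₀) (hω : ω₀ ≤ ω)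
    (hmono : ω = ω₀ ∨ 1 ≤ ω₀ * p₀) (hp : p₀ ≤ p) :
    ENNReal.ofReal ω * expWeight ω p ≤ ENNReal.ofReal ω₀ * expWeight ω₀ p := by
  rcases hmono with rfl | hω₀p₀
  · exact le_rfl
  have hω₀p : 1 ≤ ω₀ * p := hω₀p₀.trans (by gcongr)
  have hexp : Real.exp (-ω₀ * p) = Real.exp ((ω - ω₀) * p) * Real.exp (-ω * p) := by
    rw [← Real.exp_add]
    ring_nf
  rw [expWeight, expWeight, ← ENNReal.ofReal_mul (hω₀.trans hω), ← ENNReal.ofReal_mul hω₀]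
  refine ENNReal.ofReal_le_ofReal ?_
  calc ω * Real.exp (-ω * p) ≤ ω₀ * ((ω - ω₀) * p + 1) * Real.exp (-ω * p) := by
        gcongr
        nlinarith
    _ ≤ ω₀ * Real.exp ((ω - ω₀) * p) * Real.exp (-ω * p) := by
        gcongr
        exact Real.add_one_le_exp _
    _ = ω₀ * Real.exp (-ω₀ * p) := by
        rw [hexp, mul_assoc]

section Functionals

variable {d : ℕ} {N : FourierNorm} {D : Data d} {H : Wave d → ℝ → CVec d} {S : Wave d → ℝ → ℂ}
  {p₀ ω₀ ω : ℝ}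

theorem nrm_pairAbs (N : FourierNorm) (v : Wave d → CVec d) (s : Wave d → ℂ) :
    (N.nrm fun k => pairAbs (v k) (s k)) = N.enrm fun k => enormPair (v k) (s k) := by
  simp only [FourierNorm.nrm_eq_enrm, enorm_pairAbs]

theorem add_two_mul_lintegral_le_ε₁ (hB3 : B3 N D p₀ ≠ ∞) (hω : ω₀ ≤ ω) :
    B1 N D p₀ + B4 N D p₀ + 2 * B3 N D p₀ * (∫⁻ p in Ioc 0 p₀, expWeight ω p *
      N.enrm fun k => enormPair (H k p) (S k p)) ≤ ε₁ N D H S p₀ ω₀ := by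
  rw [ε₁, ← lintegral_const_mul' _ _ (ENNReal.mul_ne_top ENNReal.ofNat_ne_top hB3)]
  refine add_le_add le_rfl (setLIntegral_mono' measurableSet_Ioc fun p hp => ?_)
  have hknown (k : Wave d) :
      pairAbs (known p₀ H k p) (known p₀ S k p) = pairAbs (H k p) (S k p) := by
    rw [known, known, indicator_of_mem hp, indicator_of_mem hp]
  simp only [B2, hknown, nrm_pairAbs]
  rw [mul_left_comm]
  refine mul_le_mul' (ENNReal.ofReal_le_ofReal (Real.exp_le_exp.2 ?_)) le_rfl
  exact mul_le_mul_of_nonneg_right (neg_le_neg hω) hp.1.le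

theorem ofReal_mul_lintegral_le_b (hω₀ : 0 ≤ ω₀) (hω : ω₀ ≤ ω) (hmono : ω = ω₀ ∨ 1 ≤ ω₀ * p₀) :
    ENNReal.ofReal ω * (∫⁻ p in Ioi p₀, expWeight ω p *
      N.enrm fun k => enormPair (Hs D H S p₀ k p) (Ss D H S p₀ k p)) ≤ b N D H S p₀ ω₀ := by
  rw [b, ← lintegral_const_mul' _ _ ENNReal.ofReal_ne_top,
    ← lintegral_const_mul' _ _ ENNReal.ofReal_ne_top]
  refine setLIntegral_mono' measurableSet_Ioi fun p hp => ?_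
  rw [← mul_assoc, ← mul_assoc, nrm_pairAbs]
  exact mul_le_mul_left (mul_expWeight_le hω₀ hω hmono (le_of_lt hp)) _

theorem enrm_data_lt_top (hB3 : B3 N D p₀ ≠ 0) (hε : ε₁ N D H S p₀ ω₀ < ∞) :
    (N.enrm fun k => enormPair (D.u0 k) (D.Θ0 k)) < ∞ := by
  have hB1 : B1 N D p₀ < ∞ := (le_self_add.trans le_self_add).trans_lt hε
  rw [B1_eq] at hB1
  exact ENNReal.lt_top_of_mul_ne_top_right hB1.ne (mul_ne_zero two_ne_zero hB3)

theorem IsSolution.exists_isMajorant (hsol : IsSolution D N H S) :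
    ∃ h, IsMajorant N (fun k p => enormPair (H k p) (S k p)) h ∧
      ∀ᵐ p ∂volume.restrict (Ioi 0), h p = N.enrm fun k => enormPair (H k p) (S k p) := by
  have hmeas := hsol.aemeasurable_norm
  have hloc := hsol.locallyIntegrable
  simp only [nrm_pairAbs] at hmeas hloc
  have heq : ∀ᵐ p ∂volume.restrict (Ioi (0 : ℝ)), (Ioi 0).indicator (hmeas.mk _) p
      = N.enrm fun k => enormPair (H k p) (S k p) := by
    filter_upwards [hmeas.ae_eq_mk, ae_restrict_mem measurableSet_Ioi] with p hp hp0
    rw [indicator_of_mem hp0, hp]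
  refine ⟨_, ⟨measurable_enormPair hsol.measurable_H hsol.measurable_S,
    hmeas.measurable_mk.indicator measurableSet_Ioi,
    fun p hp => indicator_of_notMem (notMem_Ioi.2 hp) _, fun L => ?_, ?_⟩, heq⟩
  · exact (lintegral_congr_ae (ae_restrict_of_ae_restrict_of_subset Ioc_subset_Ioi_self
      heq)).trans_lt (hloc L)
  · filter_upwards [(ae_restrict_iff' measurableSet_Ioi).1 heq] with p hp hp0
    exact (hp hp0).ge

end Functionals

end Boussinesq

open Boussinesq in
theorem theorem4_general {d : ℕ} (N : FourierNorm) (hN : N.Admissible d) (hC0 : 1 ≤ N.C0 d)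
    (D : Data d) (hν : 0 < D.ν) (hμ : 0 < D.μ) (ha : 0 ≤ D.a) (he : ‖D.e‖ = 1)
    (hu₀ : Measurable D.u0) (hΘ₀ : Measurable D.Θ0) (H : Wave d → ℝ → CVec d)
    (S : Wave d → ℝ → ℂ) (hsol : IsSolution D N H S) (p₀ : ℝ) (hp₀ : 0 < p₀) (ω₀ ω : ℝ)
    (hω₀ : 0 ≤ ω₀) (hω : ω₀ ≤ ω) (hmono : ω = ω₀ ∨ 1 ≤ ω₀ * p₀)
    (hlt : ε₁ N D H S p₀ ω₀ + 2 * (B3 N D p₀ * b N D H S p₀ ω₀) ^ (1 / 2 : ℝ)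
      < ENNReal.ofReal ω) :
    ∫⁻ p in Ioi (0 : ℝ), ENNReal.ofReal (Real.exp (-ω * p)) *
      N.nrm (fun k => pairAbs (H k p) (S k p)) < ∞ := by
  have he₀ : D.e ≠ 0 := norm_ne_zero_iff.1 (he ▸ one_ne_zero)
  have hB3 : B3 N D p₀ ≠ 0 := B3_ne_zero (one_pos.trans_le hC0).ne' hν hp₀ he₀
  have hB3t : B3 N D p₀ ≠ ∞ := (B3_lt_top hN hν hμ hp₀).ne
  have hdata := enrm_data_lt_top hB3 (le_self_add.trans_lt (hlt.trans ENNReal.ofReal_lt_top))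
  obtain ⟨h, hU, heq⟩ := hsol.exists_isMajorant
  have hvolterra := (hU.ae_le_add_volterra hN hC0 hν hμ ha he hu₀ hΘ₀ hdata hsol hp₀.le).and
    (ae_restrict_of_ae_restrict_of_subset (Ioi_subset_Ioi hp₀.le) heq)
  have hcongr {A : Set ℝ} (hA : A ⊆ Ioi 0) : ∫⁻ p in A, expWeight ω p * h p
      = ∫⁻ p in A, expWeight ω p * N.enrm fun k => enormPair (H k p) (S k p) :=
    lintegral_congr_ae <| (ae_restrict_of_ae_restrict_of_subset hA heq).mono fun p hp =>
      congrArg (expWeight ω p * ·) hp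
  simp only [nrm_pairAbs]
  refine (hcongr subset_rfl).symm.trans_lt <| lintegral_expWeight_lt_top_of_volterra
    hU.measurable_majorant hU.lintegral_lt_top hp₀ hB3 hB3t (ENNReal.ofReal_pos.1 (pos_of_gt hlt))
    (hvolterra.mono fun p hp => hp.2.trans_le hp.1) (lt_of_le_of_lt ?_ hlt)
  rw [hcongr Ioc_subset_Ioi_self]
  gcongr
  exacts [add_two_mul_lintegral_le_ε₁ hB3t hω, ofReal_mul_lintegral_le_b hω₀ hω hmono]

theorem theorem4 {d : ℕ} (hd : d = 2 ∨ d = 3)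
    (N : Boussinesq.FourierNorm) (hN : N.Admissible d)
    (D : Boussinesq.Data d) (hν : 0 < D.ν) (hμ : 0 < D.μ) (ha : 0 ≤ D.a) (he : ‖D.e‖ = 1)
    (hu0_meas : Measurable D.u0) (hΘ0_meas : Measurable D.Θ0) (hf_meas : Measurable D.f)
    (hdata : N.nrm (fun k => (1 + ‖k‖) ^ 2 * Boussinesq.pairAbs (D.u0 k) (D.Θ0 k)) < ∞)
    (hf : N.nrm (fun k => ‖D.f k‖) < ∞)
    (H : Boussinesq.Wave d → ℝ → Boussinesq.CVec d) (S : Boussinesq.Wave d → ℝ → ℂ)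
    (hsol : Boussinesq.IsSolution D N H S)
    (p₀ : ℝ) (hp₀ : 0 < p₀) (ω₀ ω : ℝ) (hω₀ : 0 ≤ ω₀) (hω : ω₀ ≤ ω)
    (hmono : ω = ω₀ ∨ 1 ≤ ω₀ * p₀)
    (hlt : Boussinesq.ε₁ N D H S p₀ ω₀
        + 2 * (Boussinesq.B3 N D p₀ * Boussinesq.b N D H S p₀ ω₀) ^ (1 / 2 : ℝ)
      < ENNReal.ofReal ω) :
    ∫⁻ p in Ioi (0 : ℝ), ENNReal.ofReal (Real.exp (-ω * p)) *
      N.nrm (fun k => Boussinesq.pairAbs (H k p) (S k p)) < ∞ :=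
  theorem4_general N hN (Boussinesq.FourierNorm.one_le_C0 hd hN) D hν hμ ha he hu0_meas hΘ0_meas H S
    hsol p₀ hp₀ ω₀ ω hω₀ hω hmono hlt
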